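/- All manifolds are Hausdorff and second countable. Let $M$ be a closed (compact, without boundary) smooth manifold and $U$ a finite-dimensional smooth manifold (possibly with boundary or corners), neither of which is a single point, and let $p:E\to M$ be a smooth fibre bundle with fibre $U$. The bundle is called trivial if there is a diffeomorphism $E\to M\times U$ commuting with the projections to $M$. A space $X$ deformation retracts onto $A\subseteq X$ if there is a continuous $r:[0,1]\times X\to X$ with $r(0,x)=x$ and $r(1,x)\in A$ for all $x\in X$, and $r(t,a)=a$ for all $a\in A$, $t\in[0,1]$. (1) If for some $z_1\in E$ the space $E-\{z_1\}$ deformation retracts onto a point $z^*\in E-\{z_1\}$ or onto $p^{-1}(x^*)-\{z_1\}$ for some $x^*\in M$ (the fibre over $x^*$, punctured if it contains $z_1$), then the bundle is nontrivial. (2) Let $\dot x=f(x,u)$ be a control system on $M$ with $f:M\times U\to TM$ smooth, $f(x,u)\in T_xM$, and let $v$ be a dynamic feedback for it on $E$: a smooth vector field on $E$ which around every point of $M$ takes, in some smooth local trivialization of $p$, the form $\dot x=f(x,u)$, $\dot u=g(x,u)$. Suppose that $v$ $1$-point almost globally stabilizes some $x^*\in M$, strongly or weakly; that is, for some $z_1\in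 E$, solutions of $\dot z=v(z)$ from all points of $E-\{z_1\}$ exist and stay in $E-\{z_1\}$ for all $t\ge 0$, and the set $N$ is globally asymptotically stable for the system on $E-\{z_1\}$ (for every neighbourhood $V_1$ of $N$ there is a neighbourhood $V_2$ of $N$ such that solutions starting in $V_2$ stay in $V_1$ for all $t\ge0$, and every solution is eventually in each neighbourhood of $N$), where $N=\{z^*\}$ for an equilibrium $z^*\in p^{-1}(x^*)-\{z_1\}$ (strong) or $N=p^{-1}(x^*)-\{z_1\}$ (weak). Then the bundle is nontrivial. -/

import Mathlib

open Set Filter Topology Bundle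
open scoped Manifold ContDiff

/-- The space `X` deformation retracts onto its subset `A`: there is a continuous
`r : [0,1] × X → X` with `r(0,x) = x`, `r(1,x) ∈ A`, and `r(t,a) = a` for `a ∈ A`. -/
def DeformationRetractsOnto {X : Type*} [TopologicalSpace X] (A : Set X) : Prop :=
  ∃ r : unitInterval × X → X, Continuous r ∧
    (∀ x, r (0, x) = x) ∧ (∀ x, r (1, x) ∈ A) ∧ ∀ a ∈ A, ∀ t, r (t, a) = a

section Bundles

variable {FM HM M FU HU U FE HE E : Type*}
  [NormedAddCommGroup FM] [NormedSpace ℝ FM] [TopologicalSpace HM]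
  [TopologicalSpace M] [ChartedSpace HM M]
  [NormedAddCommGroup FU] [NormedSpace ℝ FU] [TopologicalSpace HU]
  [TopologicalSpace U] [ChartedSpace HU U]
  [NormedAddCommGroup FE] [NormedSpace ℝ FE] [TopologicalSpace HE]
  [TopologicalSpace E] [ChartedSpace HE E]

/-- A local trivialization `φ : p⁻¹(V) → V × U` over the open set `V = φ.baseSet`
(a homeomorphism commuting with the projections to `V`) is smooth if it is a diffeomorphism. -/
def IsSmoothTrivialization (IM : ModelWithCorners ℝ FM HM) (IU : ModelWithCorners ℝ FU HU)
    (IE : ModelWithCorners ℝ FE HE) {p : E → M} (φ : Trivialization U p) : Prop :=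
  ContMDiffOn IE (IM.prod IU) ∞ φ φ.source ∧
    ContMDiffOn (IM.prod IU) IE ∞ φ.toOpenPartialHomeomorph.symm φ.target

/-- `p : E → M` is a smooth fibre bundle with fibre `U`. -/
def IsSmoothFibreBundle (IM : ModelWithCorners ℝ FM HM) (IU : ModelWithCorners ℝ FU HU)
    (IE : ModelWithCorners ℝ FE HE) (p : E → M) : Prop :=
  ContMDiff IE IM ∞ p ∧
    ∀ x : M, ∃ φ : Trivialization U p, x ∈ φ.baseSet ∧ IsSmoothTrivialization IM IU IE φ

/-- The bundle `p : E → M` with fibre `U` is trivial: there is a smooth trivialization over the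
whole of `M`, that is, a diffeomorphism `E → M × U` commuting with the projections to `M`. -/
def IsTrivialBundle (IM : ModelWithCorners ℝ FM HM) (IU : ModelWithCorners ℝ FU HU)
    (IE : ModelWithCorners ℝ FE HE) (p : E → M) : Prop :=
  ∃ φ : Trivialization U p, φ.baseSet = univ ∧ IsSmoothTrivialization IM IU IE φ

/-- A control system `ẋ = f(x,u)` on `M` with controls in `U`: a smooth map `f : M × U → TM`
with `f(x,u) ∈ T_x M`. -/
def IsControlSystem (IM : ModelWithCorners ℝ FM HM) (IU : ModelWithCorners ℝ FU HU)
    [IsManifold IM 1 M] (f : (x : M) → U → TangentSpace IM x) : Prop :=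
  ContMDiff (IM.prod IU) IM.tangent ∞
    (fun q : M × U => (⟨q.1, f q.1 q.2⟩ : TangentBundle IM M))

/-- The vector field `v` on the total space of the bundle `p : E → M` with fibre `U` is (the
closed-loop system of) a dynamic feedback for `ẋ = f(x,u)`: it is smooth and, around each point
of `M`, some smooth local trivialization `φ` puts it into the form `ẋ = f(x,u)`, `u̇ = g(x,u)`;
since the second equation is unconstrained, this says that the `M`-component of `v` at the point
with `φ`-coordinates `(x,u)` is `f(x,u)`. -/
def IsDynamicFeedback (IM : ModelWithCorners ℝ FM HM) (IU : ModelWithCorners ℝ FU HU)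
    (IE : ModelWithCorners ℝ FE HE) [IsManifold IE 1 E]
    (f : (x : M) → U → TangentSpace IM x) (p : E → M) (v : (z : E) → TangentSpace IE z) : Prop :=
  ContMDiff IE IE.tangent ∞ (fun z : E => (⟨z, v z⟩ : TangentBundle IE E)) ∧
    ∀ x : M, ∃ φ : Trivialization U p, x ∈ φ.baseSet ∧ IsSmoothTrivialization IM IU IE φ ∧
      ∀ z ∈ φ.source, mfderiv IE IM p z (v z) = f (p z) (φ z).2

/-- `γ`, restricted to times `t ≥ 0`, is a solution of `ż = v(z)` that stays in the set `S`. -/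
def IsForwardSolutionIn (IE : ModelWithCorners ℝ FE HE) (v : (z : E) → TangentSpace IE z)
    (S : Set E) (γ : ℝ → E) : Prop :=
  IsMIntegralCurveOn (I := IE) γ v (Ici 0) ∧ ∀ t, 0 ≤ t → γ t ∈ S

/-- For the system `ż = v(z)` with state space the open subset `S` of `E`, the subset `N ⊆ S`
is globally asymptotically stable: solutions from all points of `S` exist in `S` for all positive
times, `N` is Lyapunov stable, and every solution converges to `N`. As `S` is open, the
neighbourhoods of `N` in `S` generate the filter `𝓝ˢ N`. -/
structure IsGloballyAsymptoticallyStable (IE : ModelWithCorners ℝ FE HE)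
    (v : (z : E) → TangentSpace IE z) (S N : Set E) : Prop where
  subset : N ⊆ S
  complete : ∀ z ∈ S, ∃ γ, γ 0 = z ∧ IsForwardSolutionIn IE v S γ
  stable : ∀ V₁ ∈ 𝓝ˢ N, ∃ V₂ ∈ 𝓝ˢ N,
    ∀ γ, IsForwardSolutionIn IE v S γ → γ 0 ∈ V₂ → ∀ t, 0 ≤ t → γ t ∈ V₁
  attractive : ∀ γ, IsForwardSolutionIn IE v S γ → Tendsto γ atTop (𝓝ˢ N)

/-- The closed-loop system `v` on `p : E → M` `1`-point almost globally strongly stabilizes `xs`: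
for some point `z₁`, an equilibrium `zs` in the fibre over `xs` is globally asymptotically stable
over `E - {z₁}`. -/
def StronglyStabilizesAlmostGlobally (IE : ModelWithCorners ℝ FE HE) (p : E → M)
    (v : (z : E) → TangentSpace IE z) (xs : M) : Prop :=
  ∃ z₁ zs : E, p zs = xs ∧ v zs = 0 ∧ IsGloballyAsymptoticallyStable IE v {z₁}ᶜ {zs}

/-- The closed-loop system `v` on `p : E → M` `1`-point almost globally weakly stabilizes `xs`:
for some point `z₁`, the fibre over `xs` (without `z₁`, in case it lies there) is globally
asymptotically stable over `E - {z₁}`. -/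
def WeaklyStabilizesAlmostGlobally (IE : ModelWithCorners ℝ FE HE) (p : E → M)
    (v : (z : E) → TangentSpace IE z) (xs : M) : Prop :=
  ∃ z₁ : E, IsGloballyAsymptoticallyStable IE v {z₁}ᶜ (p ⁻¹' {xs} \ {z₁})

end Bundles

/-! If the bundle is trivial, a constant control different from the one at `z₁` gives a section `i`
of `p` avoiding `z₁`. Deforming `i` by the retraction, or by the forward flow of `v`, and projecting
back by `p` gives a homotopy from `p ∘ i = id` to a constant map, or to a map into a small chart
ball, which contracts. So `M` would be contractible, against
`not_nullhomotopic_id_of_closed_manifold`.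

Non-contractibility is proved without homology. Embed `M` in a Euclidean space `V` with a tube of
normal vectors of length at most `ε`. A contraction `H` of `M` to `c` yields a continuous `F : V →
V`: it is the identity outside the tube and sends `e x + v` to `e (H (s, x))` plus a normal vector
transported from `v` along the homotopy, where `s` grows from `0` on the boundary of the tube to `1`
on its core. Transport is injective on normal vectors, so `F` hits `e M` only from the core, that
is, only at `e c`. Yet a continuous self-map that is the identity off a bounded set is surjective.

Surjectivity rests on the integral of `det DF` over a ball depending only on `F` off the ball
(`setIntegral_det_fderiv_eq_of_eqOn_compl`). In the control case the remaining work is joint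
continuity of the forward flow (`continuousOn_flow`), proved with one-sided estimates because `E`
may have boundary or corners. -/

/-! ### The integral of the Jacobian determinant -/

section BrouwerDegree

open MeasureTheory

variable {V : Type*} [NormedAddCommGroup V] [NormedSpace ℝ V]

/-- The dilation outweighs `F`, which gives injectivity; preimages of `y` are the fixed points of
the contraction `x ↦ c⁻¹ • (y - F x)`. -/
theorem LipschitzWith.bijective_smul_add [CompleteSpace V] {F : V → V} {K : NNReal} {c : ℝ}
    (hF : LipschitzWith K F) (hc : K < c) : Function.Bijective fun x => c • x + F x := by
  have hc0 : 0 < c := K.coe_nonneg.trans_lt hc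
  constructor
  · intro x y hxy
    by_contra hne
    have h1 : c • (x - y) = F y - F x := by
      rw [smul_sub, sub_eq_sub_iff_add_eq_add]
      simpa [add_comm] using hxy
    have h2 : c * ‖x - y‖ ≤ K * ‖x - y‖ := by
      have := hF.norm_sub_le y x
      rwa [← h1, norm_smul, Real.norm_of_nonneg hc0.le, norm_sub_rev y x] at this
    have h3 : 0 < ‖x - y‖ := norm_pos_iff.2 (sub_ne_zero.2 hne)
    nlinarith
  · intro y
    let g : V → V := fun x => c⁻¹ • (y - F x)
    have hg : ContractingWith (Real.toNNReal c⁻¹ * K) g := by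
      refine ⟨?_, LipschitzWith.of_dist_le_mul fun a b => ?_⟩
      · rw [← NNReal.coe_lt_coe]
        push_cast
        rw [Real.coe_toNNReal _ (inv_nonneg.2 hc0.le), inv_mul_lt_iff₀ hc0]
        simpa using hc
      · simp only [g, dist_eq_norm]
        rw [← smul_sub, norm_smul, Real.norm_of_nonneg (inv_nonneg.2 hc0.le), NNReal.coe_mul,
          Real.coe_toNNReal _ (inv_nonneg.2 hc0.le), mul_assoc]
        gcongr
        rw [sub_sub_sub_cancel_left, norm_sub_rev a b]
        exact hF.norm_sub_le b a
    refine ⟨hg.fixedPoint, ?_⟩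
    have h := hg.fixedPoint_isFixedPt
    set x := ContractingWith.fixedPoint g hg
    have h' : c⁻¹ • (y - F x) = x := h
    change c • x + F x = y
    nth_rewrite 1 [← h']
    rw [smul_smul, mul_inv_cancel₀ hc0.ne', one_smul, sub_add_cancel]

variable [FiniteDimensional ℝ V]

/-- Along the segment `c + s A` the map stays invertible, so the determinant keeps the sign it has
at `s = 0`. -/
theorem ContinuousLinearMap.det_smul_one_add_pos {A : V →L[ℝ] V} {c : ℝ} (hc : ‖A‖ < c) :
    0 < (c • (1 : V →L[ℝ] V) + A).det := by
  have hc0 : 0 < c := (norm_nonneg A).trans_lt hc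
  let f : ℝ → ℝ := fun s => (c • (1 : V →L[ℝ] V) + s • A).det
  have hf : Continuous f := ContinuousLinearMap.continuous_det.comp (by fun_prop)
  have hne : ∀ s ∈ Icc (0 : ℝ) 1, f s ≠ 0 := by
    intro s hs
    have hinj : Function.Injective (c • (1 : V →L[ℝ] V) + s • A) := by
      have hl : LipschitzWith ‖s • A‖₊ (s • A) := (s • A).lipschitz
      refine (hl.bijective_smul_add (c := c) ?_).1
      rw [coe_nnnorm, norm_smul, Real.norm_of_nonneg hs.1]
      nlinarith [norm_nonneg A, hs.2]
    have hu : IsUnit ((c • (1 : V →L[ℝ] V) + s • A : V →L[ℝ] V) : V →ₗ[ℝ] V) :=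
      (LinearMap.isUnit_iff_ker_eq_bot _).2 (LinearMap.ker_eq_bot.2 hinj)
    exact (LinearMap.isUnit_iff_isUnit_det _).1 hu |>.ne_zero
  have h0 : 0 < f 0 := by
    simp only [f, zero_smul, add_zero]
    change 0 < LinearMap.det ((c • (1 : V →L[ℝ] V) : V →L[ℝ] V) : V →ₗ[ℝ] V)
    have : ((c • (1 : V →L[ℝ] V) : V →L[ℝ] V) : V →ₗ[ℝ] V) = c • LinearMap.id := rfl
    rw [this, LinearMap.det_smul, LinearMap.det_id]
    positivity
  have h1 : 0 < f 1 := by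
    by_contra! h
    obtain ⟨s, hs, hs0⟩ := intermediate_value_Icc' zero_le_one hf.continuousOn ⟨h, h0.le⟩
    exact hne s hs hs0
  simpa [f] using h1

/-- `det (c + A)` is the characteristic polynomial of `-A` at `c`, of degree `dim V`. Its value at
`0` is therefore interpolated from `dim V + 1` nodes, which may all be taken large, where `c + A` is
well behaved. -/
theorem ContinuousLinearMap.det_eq_sum_lagrange (a : Fin (Module.finrank ℝ V + 1) → ℝ)
    (ha : Function.Injective a) (A : V →L[ℝ] V) :
    A.det = ∑ i, (a i • (1 : V →L[ℝ] V) + A).det *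
      (Lagrange.basis Finset.univ a i).eval 0 := by
  let p : Polynomial ℝ := (-A : V →L[ℝ] V).toLinearMap.charpoly
  have hp : ∀ c, p.eval c = (c • (1 : V →L[ℝ] V) + A).det := by
    intro c
    simp only [p]
    rw [LinearMap.eval_charpoly]
    change LinearMap.det _ = LinearMap.det _
    congr 1
    ext v
    simp
  have hdeg : p.degree < (Finset.univ : Finset (Fin (Module.finrank ℝ V + 1))).card := by
    rw [Finset.card_univ, Fintype.card_fin, Polynomial.degree_eq_natDegree
      (LinearMap.charpoly_monic _).ne_zero, LinearMap.charpoly_natDegree]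
    exact_mod_cast Nat.lt_succ_self _
  have h := Lagrange.eq_interpolate (s := Finset.univ) (v := a) ha.injOn hdeg
  have h0 := hp 0
  rw [zero_smul, zero_add] at h0
  rw [← h0, h, Lagrange.interpolate_apply, Polynomial.eval_finsetSum]
  refine Finset.sum_congr rfl fun i _ => ?_
  rw [Polynomial.eval_mul, Polynomial.eval_C, hp]

variable [MeasurableSpace V] [BorelSpace V] (μ : Measure V) [μ.IsAddHaarMeasure]

/-- The Jacobian determinant is a null Lagrangian. -/
theorem setIntegral_det_fderiv_eq_of_eqOn_compl {F G : V → V} {K : NNReal} {R : ℝ}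
    (hF : ContDiff ℝ 1 F) (hG : ContDiff ℝ 1 G) (hFK : LipschitzWith K F)
    (hGK : LipschitzWith K G) (hFG : ∀ x ∉ Metric.closedBall (0 : V) R, F x = G x) :
    ∫ x in Metric.closedBall (0 : V) R, (fderiv ℝ F x).det ∂μ =
      ∫ x in Metric.closedBall (0 : V) R, (fderiv ℝ G x).det ∂μ := by
  set B := Metric.closedBall (0 : V) R
  have hcont : ∀ {F : V → V} (_ : ContDiff ℝ 1 F) (c : ℝ),
      Continuous fun x => (c • (1 : V →L[ℝ] V) + fderiv ℝ F x).det := fun hF c =>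
    ContinuousLinearMap.continuous_det.comp
      (continuous_const.add (hF.continuous_fderiv one_ne_zero))
  -- For `c > K` the map `c • x + F x` is injective with positive Jacobian, so the integral is the
  -- volume of an image.
  have himg : ∀ {F : V → V} (_ : ContDiff ℝ 1 F) (_ : LipschitzWith K F) (c : ℝ) (_ : K < c),
      ∫ x in B, (c • (1 : V →L[ℝ] V) + fderiv ℝ F x).det ∂μ =
        ∫ _ in (fun x => c • x + F x) '' B, (1 : ℝ) ∂μ := by
    intro F hF hFK c hc
    rw [integral_image_eq_integral_abs_det_fderiv_smul μ Metric.isClosed_closedBall.measurableSet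
      (f' := fun x => c • (1 : V →L[ℝ] V) + fderiv ℝ F x) _
      (hFK.bijective_smul_add hc).1.injOn]
    · refine setIntegral_congr_fun Metric.isClosed_closedBall.measurableSet fun x _ => ?_
      simp only [smul_eq_mul, mul_one]
      rw [abs_of_pos]
      exact ContinuousLinearMap.det_smul_one_add_pos
        ((norm_fderiv_le_of_lipschitz ℝ hFK).trans_lt hc)
    · intro x _
      exact (((hasFDerivAt_id x).const_smul c).add
        (hF.differentiable one_ne_zero x).hasFDerivAt).hasFDerivWithinAt
  have key : ∀ c : ℝ, K < c → ∫ x in B, (c • (1 : V →L[ℝ] V) + fderiv ℝ F x).det ∂μ =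
      ∫ x in B, (c • (1 : V →L[ℝ] V) + fderiv ℝ G x).det ∂μ := by
    intro c hc
    rw [himg hF hFK c hc, himg hG hGK c hc]
    congr 2
    -- Both maps are bijections that agree off `B`, so their images of `B` have the same complement.
    have hcompl : (fun x => c • x + F x) '' Bᶜ = (fun x => c • x + G x) '' Bᶜ :=
      image_congr fun x hx => by simp only [hFG x hx]
    rw [image_compl_eq (hFK.bijective_smul_add hc), image_compl_eq (hGK.bijective_smul_add hc)]
      at hcompl
    exact compl_injective hcompl
  -- Distinct nodes, all above the Lipschitz constant `K`, so that `key` applies to each.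
  let a : Fin (Module.finrank ℝ V + 1) → ℝ := fun i => K + 1 + (i : ℕ)
  have ha : Function.Injective a := fun i j h => by
    simpa [a, Fin.val_inj] using h
  have hexp : ∀ {F : V → V} (_ : ContDiff ℝ 1 F), ∫ x in B, (fderiv ℝ F x).det ∂μ =
      ∑ i, (∫ x in B, (a i • (1 : V →L[ℝ] V) + fderiv ℝ F x).det ∂μ) *
        (Lagrange.basis Finset.univ a i).eval 0 := by
    intro F hF
    simp_rw [← integral_mul_const]
    rw [← integral_finsetSum]
    · exact integral_congr_ae (Eventually.of_forall fun x =>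
        ContinuousLinearMap.det_eq_sum_lagrange a ha _)
    · intro i _
      exact (((hcont hF (a i)).mul continuous_const).continuousOn.integrableOn_compact
        (isCompact_closedBall _ _))
  rw [hexp hF, hexp hG]
  refine Finset.sum_congr rfl fun i _ => ?_
  rw [key]
  have : (0 : ℝ) ≤ (i : ℕ) := Nat.cast_nonneg _
  simp only [a]
  linarith

end BrouwerDegree

/-! ### Surjectivity of maps that are the identity near infinity -/

section BrouwerSurjectivity

open MeasureTheory

variable {ι : Type*} [Fintype ι]

theorem ContinuousLinearMap.det_pi_smul_proj [DecidableEq ι] (d : ι → ℝ) :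
    (ContinuousLinearMap.pi fun i => d i • ContinuousLinearMap.proj (R := ℝ) (φ := fun _ : ι => ℝ) i :
      (ι → ℝ) →L[ℝ] (ι → ℝ)).det = ∏ i, d i := by
  have : ((ContinuousLinearMap.pi fun i =>
      d i • ContinuousLinearMap.proj (R := ℝ) (φ := fun _ : ι => ℝ) i :
      (ι → ℝ) →L[ℝ] (ι → ℝ)) : (ι → ℝ) →ₗ[ℝ] (ι → ℝ)) = Matrix.toLin' (Matrix.diagonal d) := by
    ext j i
    simp [Matrix.mulVec_diagonal]
  change LinearMap.det _ = _
  rw [this, LinearMap.det_toLin', Matrix.det_diagonal]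

/-- A `C¹` self-map of `ℝⁿ` that is the identity near infinity comes close to every point. -/
theorem exists_dist_lt_of_contDiff_of_eqOn_compl {F : (ι → ℝ) → (ι → ℝ)} {R : ℝ}
    (hF : ContDiff ℝ 1 F) (hR : ∀ x ∉ Metric.closedBall 0 R, F x = x) (q : ι → ℝ) {r : ℝ}
    (hr : 0 < r) : ∃ x, dist (F x) q < r := by
  classical
  by_contra! hfar
  -- With a tent function `b` and its primitive `θ`, the coordinatewise map `ψ` has Jacobian `∏ b (y
  -- i - q i)`, which vanishes off the sup-norm `r`-ball about `q`. If `F` avoids that ball, `ψ ∘ F`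
  -- has zero Jacobian, while `ψ` has positive Jacobian integral; but the two maps agree near
  -- infinity.
  let b : ℝ → ℝ := fun u => max 0 (r - |u|)
  have hb : Continuous b := by fun_prop
  have hb0 : ∀ u, 0 ≤ b u := fun u => le_max_left _ _
  have hbr : ∀ u, b u ≤ r := fun u => max_le hr.le (by linarith [abs_nonneg u])
  let θ : ℝ → ℝ := fun s => ∫ u in (0 : ℝ)..s, b u
  have hθ : ∀ s, HasDerivAt θ (b s) s := fun s =>
    intervalIntegral.integral_hasDerivAt_right (hb.intervalIntegrable _ _)
      hb.stronglyMeasurable.stronglyMeasurableAtFilter hb.continuousAt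
  have hdθ : deriv θ = b := funext fun s => (hθ s).deriv
  have hθ1 : ContDiff ℝ 1 θ :=
    contDiff_one_iff_deriv.2 ⟨fun s => (hθ s).differentiableAt, by rwa [hdθ]⟩
  have hθL : LipschitzWith r.toNNReal θ := by
    refine lipschitzWith_of_nnnorm_deriv_le (fun s => (hθ s).differentiableAt) fun s => ?_
    rw [hdθ, ← NNReal.coe_le_coe, coe_nnnorm, Real.coe_toNNReal _ hr.le,
      Real.norm_of_nonneg (hb0 s)]
    exact hbr s
  let ψ : (ι → ℝ) → (ι → ℝ) := fun y i => θ (y i - q i)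
  let ψ' : (ι → ℝ) → (ι → ℝ) →L[ℝ] (ι → ℝ) := fun y =>
    ContinuousLinearMap.pi fun i =>
      b (y i - q i) • ContinuousLinearMap.proj (R := ℝ) (φ := fun _ : ι => ℝ) i
  have hψ : ∀ y, HasFDerivAt ψ (ψ' y) y := fun y => by
    refine hasFDerivAt_pi.2 fun i => ?_
    have h : HasFDerivAt (fun y : ι → ℝ => y i - q i)
        (ContinuousLinearMap.proj (R := ℝ) (φ := fun _ : ι => ℝ) i) y :=
      (ContinuousLinearMap.proj (R := ℝ) (φ := fun _ : ι => ℝ) i).hasFDerivAt.sub_const (q i)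
    exact (hθ (y i - q i)).comp_hasFDerivAt y h
  have hψ1 : ContDiff ℝ 1 ψ := contDiff_pi.2 fun i =>
    hθ1.comp ((contDiff_apply ℝ ℝ i).sub contDiff_const)
  have hψL : LipschitzWith r.toNNReal ψ := by
    refine LipschitzWith.of_dist_le_mul fun x y => ?_
    refine (dist_pi_le_iff (by positivity)).2 fun i => ?_
    refine (hθL.dist_le_mul _ _).trans ?_
    rw [dist_sub_right]
    gcongr
    exact dist_le_pi_dist x y i
  have hFid : ContDiff ℝ 1 fun x => F x - x := hF.sub contDiff_id
  have hsupp : HasCompactSupport fun x => F x - x :=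
    HasCompactSupport.intro (isCompact_closedBall 0 R) fun x hx => by rw [hR x hx, sub_self]
  obtain ⟨C, hC⟩ := hFid.lipschitzWith_of_hasCompactSupport hsupp one_ne_zero
  have hFL : LipschitzWith (C + 1) F := by
    have := hC.add LipschitzWith.id
    simpa using this
  -- Large enough that `F` is the identity outside and that the unit ball about `q` lies inside.
  set R' := max R (‖q‖ + 1)
  set B := Metric.closedBall (0 : ι → ℝ) R'
  have hdet : ∀ y, (fderiv ℝ ψ y).det = ∏ i, b (y i - q i) := fun y => by
    rw [(hψ y).fderiv]
    exact ContinuousLinearMap.det_pi_smul_proj _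
  have hzero : ∀ x, (fderiv ℝ (ψ ∘ F) x).det = 0 := by
    intro x
    rw [fderiv_comp x (hψ _).differentiableAt (hF.differentiable one_ne_zero x)]
    change LinearMap.det ((fderiv ℝ ψ (F x) : (ι → ℝ) →ₗ[ℝ] (ι → ℝ)) ∘ₗ
      (fderiv ℝ F x : (ι → ℝ) →ₗ[ℝ] (ι → ℝ))) = 0
    rw [LinearMap.det_comp]
    refine mul_eq_zero_of_left ((hdet (F x)).trans ?_) _
    have hx := hfar x
    obtain ⟨i, hi⟩ : ∃ i, r ≤ dist (F x i) (q i) := by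
      by_contra! h
      exact hx.not_gt ((dist_pi_lt_iff hr).2 h)
    refine Finset.prod_eq_zero (Finset.mem_univ i) (max_eq_left ?_)
    rw [Real.dist_eq] at hi
    linarith
  have heq := setIntegral_det_fderiv_eq_of_eqOn_compl (volume : Measure (ι → ℝ)) (R := R')
    (hψ1.comp hF) hψ1 ((hψL.comp hFL).weaken (le_max_left _ r.toNNReal))
    (hψL.weaken (le_max_right _ _)) fun x hx => by
      rw [Function.comp_apply, hR x fun h => hx (Metric.closedBall_subset_closedBall
        (le_max_left _ _) h)]
  simp only [hzero, hdet, integral_zero] at heq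
  have hcont : Continuous fun y : ι → ℝ => ∏ i, b (y i - q i) := by fun_prop
  have hpos : 0 < ∫ y in B, ∏ i, b (y i - q i) := by
    rw [setIntegral_pos_iff_support_of_nonneg_ae
      (Eventually.of_forall fun y => Finset.prod_nonneg fun i _ => hb0 _)
      (hcont.continuousOn.integrableOn_compact (isCompact_closedBall _ _))]
    refine (Metric.measure_ball_pos volume q (lt_min hr one_pos)).trans_le (measure_mono ?_)
    intro y hy
    rw [Metric.mem_ball, lt_min_iff] at hy
    refine ⟨(Finset.prod_pos fun i _ => lt_max_of_lt_right ?_).ne', ?_⟩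
    · have := (dist_le_pi_dist y q i).trans_lt hy.1
      rw [Real.dist_eq] at this
      linarith
    · rw [mem_closedBall_zero_iff]
      have : ‖y‖ ≤ ‖q‖ + ‖y - q‖ := norm_le_norm_add_norm_sub' y q
      rw [← dist_eq_norm] at this
      exact le_max_of_le_right (by linarith [hy.2])
  exact hpos.ne heq

/-- A continuous self-map of a finite-dimensional space that is the identity near infinity is
surjective. -/
theorem surjective_of_continuous_of_eqOn_compl {V : Type*} [NormedAddCommGroup V]
    [NormedSpace ℝ V] [FiniteDimensional ℝ V] {F : V → V} (hF : Continuous F) {s : Set V}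
    (hs : Bornology.IsBounded s) (hFs : ∀ x ∉ s, F x = x) : Function.Surjective F := by
  let L : V ≃L[ℝ] (Fin (Module.finrank ℝ V) → ℝ) :=
    ContinuousLinearEquiv.ofFinrankEq (by simp)
  let G : (Fin (Module.finrank ℝ V) → ℝ) → (Fin (Module.finrank ℝ V) → ℝ) :=
    fun x => L (F (L.symm x))
  have hG : Continuous G := by fun_prop
  obtain ⟨R, hR⟩ := (L.lipschitz.isBounded_image hs).subset_closedBall 0
  have hGR : ∀ x ∉ Metric.closedBall 0 R, G x = x := fun x hx => by
    simp only [G]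
    rw [hFs, L.apply_symm_apply]
    exact fun h => hx (hR ⟨_, h, L.apply_symm_apply x⟩)
  suffices h : ∀ q, ∃ x, G x = q by
    intro y
    obtain ⟨x, hx⟩ := h (L y)
    exact ⟨L.symm x, L.injective hx⟩
  intro q
  by_contra! hq
  have hclosed : IsClosed (range G) := by
    -- The range is a compact image together with a region where `G` is the identity; hence a missed
    -- point has a whole missed ball.
    have : range G = G '' Metric.closedBall 0 (R + 1) ∪ (Metric.ball 0 (R + 1))ᶜ := by
      have hfix : ∀ x ∉ Metric.ball 0 (R + 1), G x = x := fun x hx => hGR x fun h =>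
        hx (Metric.closedBall_subset_ball (lt_add_one R) h)
      refine Subset.antisymm ?_ (union_subset (image_subset_range _ _) fun x hx =>
        ⟨x, hfix x hx⟩)
      rintro _ ⟨x, rfl⟩
      by_cases hx : x ∈ Metric.ball 0 (R + 1)
      · exact Or.inl ⟨x, Metric.ball_subset_closedBall hx, rfl⟩
      · right
        rw [hfix x hx]
        exact hx
    rw [this]
    exact ((isCompact_closedBall _ _).image hG).isClosed.union Metric.isOpen_ball.isClosed_compl
  obtain ⟨r, hr, hball⟩ := Metric.isOpen_iff.1 hclosed.isOpen_compl q
    (by rintro ⟨x, hx⟩; exact hq x hx)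
  -- Smoothing `G - id` rather than `G` preserves the support, so `g + id` is still the identity off
  -- the ball.
  obtain ⟨g, hg, hgd, hgs⟩ := (hG.sub continuous_id).exists_contDiff_approx 1
    (ε := fun _ => r / 2) continuous_const fun _ => half_pos hr
  have hg0 : ∀ x ∉ Metric.closedBall 0 R, g x = 0 := fun x hx => by
    by_contra h
    exact hgs h (by simp [hGR x hx])
  obtain ⟨x, hx⟩ := exists_dist_lt_of_contDiff_of_eqOn_compl (F := fun x => g x + x) (R := R)
    (hg.add contDiff_id) (fun x hx => by rw [hg0 x hx, zero_add]) q (half_pos hr)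
  refine hball (Metric.mem_ball.2 ?_) (mem_range_self x)
  have h1 := hgd x
  have h2 : dist (G x) (g x + x) = dist (g x) (G x - x) := by
    rw [dist_comm, dist_eq_norm, dist_eq_norm]
    congr 1
    abel
  calc dist (G x) q ≤ dist (G x) (g x + x) + dist (g x + x) q := dist_triangle _ _ _
    _ < r / 2 + r / 2 := by
      rw [h2]
      exact add_lt_add h1 hx
    _ = r := add_halves r

end BrouwerSurjectivity

/-! ### From a contraction of the core to a non-surjective map of the tube -/

section Tube

open unitInterval

variable {V : Type*} [NormedAddCommGroup V] [NormedSpace ℝ V]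
  {M : Type*}

/-- The time `t` truncated at the `j`-th of `m` equally spaced nodes of the unit interval. -/
noncomputable def truncatedTime (m j : ℕ) (t : I) : I :=
  min t (projIcc 0 1 zero_le_one ((j : ℝ) / m))

theorem continuous_truncatedTime (m j : ℕ) : Continuous (truncatedTime m j) :=
  continuous_id.min continuous_const

theorem truncatedTime_zero_left (m j : ℕ) : truncatedTime m j 0 = 0 :=
  min_eq_left (nonneg' (t := _))

theorem truncatedTime_zero_right (m : ℕ) (t : I) : truncatedTime m 0 t = 0 := by
  rw [truncatedTime, Nat.cast_zero, zero_div, projIcc_left]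
  exact min_eq_right nonneg'

theorem truncatedTime_self {m : ℕ} (hm : m ≠ 0) (t : I) : truncatedTime m m t = t := by
  refine min_eq_left ?_
  rw [div_self (by exact_mod_cast hm), projIcc_right]
  exact le_one'

theorem dist_truncatedTime_succ (m j : ℕ) (t : I) :
    dist (truncatedTime m (j + 1) t) (truncatedTime m j t) ≤ 1 / m := by
  set a := projIcc (0 : ℝ) 1 zero_le_one (((j + 1 : ℕ) : ℝ) / m)
  set b := projIcc (0 : ℝ) 1 zero_le_one ((j : ℝ) / m)
  have h1 : dist (truncatedTime m (j + 1) t) (truncatedTime m j t) ≤ dist a b := by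
    rw [Subtype.dist_eq, Subtype.dist_eq, Real.dist_eq, Real.dist_eq]
    have := abs_min_sub_min_le_max (t : ℝ) a t b
    rwa [sub_self, abs_zero, max_eq_right (abs_nonneg _)] at this
  refine h1.trans (((LipschitzWith.projIcc zero_le_one).dist_le_mul _ _).trans ?_)
  rw [NNReal.coe_one, one_mul, Real.dist_eq, ← sub_div, Nat.cast_succ, add_sub_cancel_left,
    abs_of_nonneg (by positivity)]

/-- Discretised parallel transport of vectors along the homotopy `h` by means of the family `P` of
projections. -/
noncomputable def projectionTransport (P : M → V →L[ℝ] V) (h : I × M → M) (m : ℕ) :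
    ℕ → I × M → V →L[ℝ] V
  | 0, z => P (h (0, z.2))
  | j + 1, z => P (h (truncatedTime m (j + 1) z.1, z.2)) ∘L projectionTransport P h m j z

variable {P : M → V →L[ℝ] V} {h : I × M → M} {m : ℕ}

theorem continuous_projectionTransport [TopologicalSpace M] (hP : Continuous P) (hh : Continuous h) (j : ℕ) :
    Continuous (projectionTransport P h m j) := by
  induction j with
  | zero => exact hP.comp (hh.comp (by fun_prop))
  | succ j ih =>
    have h1 : Continuous fun z : I × M => P (h (truncatedTime m (j + 1) z.1, z.2)) :=
      hP.comp (hh.comp (((continuous_truncatedTime m (j + 1)).comp continuous_fst).prodMk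
        continuous_snd))
    exact h1.clm_comp ih

theorem norm_projectionTransport_le (hPn : ∀ x v, ‖P x v‖ ≤ ‖v‖) (j : ℕ) (z : I × M) (v : V) :
    ‖projectionTransport P h m j z v‖ ≤ ‖v‖ := by
  induction j with
  | zero => exact hPn _ _
  | succ j ih => exact (hPn _ _).trans ih

theorem projection_projectionTransport (hPP : ∀ x v, P x (P x v) = P x v) (j : ℕ) (z : I × M)
    (v : V) : P (h (truncatedTime m j z.1, z.2)) (projectionTransport P h m j z v) =
      projectionTransport P h m j z v := by
  cases j with
  | zero =>
    rw [truncatedTime_zero_right]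
    exact hPP _ _
  | succ j => exact hPP _ _

theorem projectionTransport_zero_time (j : ℕ) {x : M} {v : V} (hv : P (h (0, x)) v = v) :
    projectionTransport P h m j (0, x) v = v := by
  induction j with
  | zero => exact hv
  | succ j ih =>
    change P (h (truncatedTime m (j + 1) 0, x)) (projectionTransport P h m j (0, x) v) = v
    rw [ih, truncatedTime_zero_left, hv]

/-- Each step is injective: if `P u = u` and `P' u = 0` with `‖P' - P‖ < 1`, then `‖u‖ = ‖(P' - P)
u‖`, which forces `u = 0`. -/
theorem eq_zero_of_projectionTransport_eq_zero (hPP : ∀ x v, P x (P x v) = P x v)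
    (hstep : ∀ s t x, dist s t ≤ 1 / m → ‖P (h (s, x)) - P (h (t, x))‖ < 1) (j : ℕ) {z : I × M}
    {v : V} (hv : P (h (0, z.2)) v = v) (h0 : projectionTransport P h m j z v = 0) : v = 0 := by
  induction j with
  | zero => rw [← hv]; exact h0
  | succ j ih =>
    refine ih ?_
    set u := projectionTransport P h m j z v
    have hu := projection_projectionTransport (h := h) (m := m) hPP j z v
    have h0' : P (h (truncatedTime m (j + 1) z.1, z.2)) u = 0 := h0
    by_contra hne
    have h1 := hstep _ _ z.2 (dist_truncatedTime_succ m j z.1)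
    have h2 := (P (h (truncatedTime m (j + 1) z.1, z.2)) -
      P (h (truncatedTime m j z.1, z.2))).le_opNorm u
    rw [sub_apply, h0', hu, zero_sub, norm_neg] at h2
    have h3 : 0 < ‖u‖ := norm_pos_iff.2 hne
    nlinarith

/-- Currying gives a continuous map from `I` to `C(M, W)`, uniformly continuous since `I` is
compact; this makes one step size work for all points of `M`. -/
theorem exists_forall_norm_sub_lt_one [TopologicalSpace M] [CompactSpace M] {W : Type*} [NormedAddCommGroup W]
    {g : I × M → W} (hg : Continuous g) :
    ∃ m : ℕ, m ≠ 0 ∧ ∀ s t x, dist s t ≤ 1 / (m : ℝ) → ‖g (s, x) - g (t, x)‖ < 1 := by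
  let G : C(I, C(M, W)) := ContinuousMap.curry ⟨g, hg⟩
  have hG := CompactSpace.uniformContinuous_of_continuous G.continuous
  obtain ⟨δ, hδ, hGδ⟩ := Metric.uniformContinuous_iff.1 hG 1 one_pos
  obtain ⟨m, hm⟩ := exists_nat_one_div_lt hδ
  refine ⟨m + 1, m.succ_ne_zero, fun s t x hst => ?_⟩
  have h1 := hGδ (hst.trans_lt (by exact_mod_cast hm))
  rw [← dist_eq_norm]
  exact (ContinuousMap.dist_apply_le_dist (f := G s) (g := G t) x).trans_lt h1

/-- A compact space with a tubular neighbourhood in a finite-dimensional vector space is not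
contractible. -/
theorem not_nullhomotopic_id_of_tube [FiniteDimensional ℝ V] [TopologicalSpace M]
    [CompactSpace M] [Nontrivial M]
    {e : M → V} (he : Continuous e) (hP : Continuous P) (hPn : ∀ x v, ‖P x v‖ ≤ ‖v‖)
    (hPP : ∀ x v, P x (P x v) = P x v)
    (hnear : ∀ x y, (∀ x', ‖y - e x‖ ≤ ‖y - e x'‖) → P x (y - e x) = y - e x)
    {ε : ℝ} (hε : 0 < ε)
    (huniq : ∀ x x' v v', P x v = v → P x' v' = v' → ‖v‖ ≤ ε → ‖v'‖ ≤ ε →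
      e x + v = e x' + v' → x = x') :
    ¬ (ContinuousMap.id M).Nullhomotopic := by
  rintro ⟨c, ⟨H⟩⟩
  have hinj : Function.Injective e := fun x x' hx =>
    huniq x x' 0 0 (map_zero _) (map_zero _) (by simp [hε.le]) (by simp [hε.le]) (by simp [hx])
  have hT2 : T2Space M := T2Space.of_injective_continuous hinj he
  have hmin : ∀ y : V, ∃ x, ∀ x', ‖y - e x‖ ≤ ‖y - e x'‖ := fun y => by
    obtain ⟨x, -, hx⟩ := isCompact_univ.exists_isMinOn (f := fun x => ‖y - e x‖) univ_nonempty
      (by fun_prop)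
    exact ⟨x, fun x' => hx (mem_univ x')⟩
  choose r hr using hmin
  let d : V → ℝ := fun y => ‖y - e (r y)‖
  have hd : Continuous d := by
    refine (LipschitzWith.of_le_add fun y z => ?_).continuous
    calc d y ≤ ‖y - e (r z)‖ := hr y _
      _ = ‖(z - e (r z)) + (y - z)‖ := by congr 1; abel
      _ ≤ d z + dist y z := by rw [dist_eq_norm]; exact norm_add_le _ _
  have hrP : ∀ y, P (r y) (y - e (r y)) = y - e (r y) := fun y => hnear _ _ (hr y)
  -- The nearest point `r y` was chosen arbitrarily, but in the tube it is unique. Any cluster point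
  -- of `r` at `y` is again nearest to `y`, and compactness of `M` then gives continuity.
  have hrc : ContinuousOn r {y | d y ≤ ε} := by
    intro y hy
    refine isCompact_univ.tendsto_nhds_of_unique_mapClusterPt (Eventually.of_forall fun _ =>
      mem_univ _) fun x _ hx => ?_
    obtain ⟨U, hU, hUx⟩ := mapClusterPt_iff_ultrafilter.1 hx
    have hUy : Tendsto id (U : Filter V) (𝓝 y) := hU.trans nhdsWithin_le_nhds
    have h1 : Tendsto d U (𝓝 ‖y - e x‖) := (hUy.sub ((he.tendsto x).comp hUx)).norm
    have h2 : ‖y - e x‖ = d y := tendsto_nhds_unique h1 ((hd.tendsto y).comp hUy)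
    refine huniq _ _ (y - e x) (y - e (r y)) (hnear _ _ fun x' => h2.trans_le (hr y x')) (hrP y)
      (h2.trans_le hy) hy (by abel)
  obtain ⟨m, hm, hstep⟩ := exists_forall_norm_sub_lt_one (hP.comp H.continuous)
  -- Equal to `0` where `d = ε` and to `1` on the core, where `d = 0`.
  let lam : V → I := fun y => projIcc 0 1 zero_le_one (1 - d y / ε)
  have hlam : Continuous lam := continuous_projIcc.comp (by fun_prop)
  let G : V → V := fun y =>
    e (H (lam y, r y)) + projectionTransport P H m m (lam y, r y) (y - e (r y))
  have hH0 : ∀ x, H (0, x) = x := fun x => H.map_zero_left x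
  have hG : ContinuousOn G {y | d y ≤ ε} := by
    have h1 : ContinuousOn (fun y => (lam y, r y)) {y | d y ≤ ε} := hlam.continuousOn.prodMk hrc
    exact ((he.comp H.continuous).comp_continuousOn h1).add
      (((continuous_projectionTransport hP H.continuous m).comp_continuousOn h1).clm_apply
        (continuousOn_id.sub (he.comp_continuousOn hrc)))
  classical
  let F : V → V := fun y => if d y ≤ ε then G y else y
  have hF : Continuous F := by
    refine continuous_if (fun y hy => ?_) ?_ continuous_id.continuousOn
    -- At time `0` neither the base point nor the normal vector moves, so the two branches of `F`
    -- agree on the boundary.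
    · have hy' : d y = ε := frontier_le_subset_eq hd continuous_const hy
      have h0 : lam y = 0 := by
        simp only [lam, hy', div_self hε.ne', sub_self]
        exact projIcc_left zero_le_one
      simp only [G, h0]
      rw [hH0, projectionTransport_zero_time m (by rw [hH0, hrP]), add_sub_cancel]
    · rwa [(isClosed_le hd continuous_const).closure_eq]
  have hbdd : Bornology.IsBounded {y | d y ≤ ε} := by
    refine ((isCompact_range he).isBounded.cthickening (δ := ε)).subset fun y hy => ?_
    exact Metric.mem_cthickening_of_dist_le y (e (r y)) ε _ (mem_range_self _)
      (by rw [dist_eq_norm]; exact hy)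
  obtain ⟨xq, hxq⟩ := exists_ne c
  obtain ⟨y, hy⟩ := surjective_of_continuous_of_eqOn_compl hF hbdd
    (fun y hy => if_neg hy) (e xq)
  -- Inside the tube, uniqueness of normal coordinates makes the transported vector zero, so `y` is
  -- on the core and is sent to `e c`, not `e xq`. Outside, `y = e xq` would be at distance zero
  -- from the core.
  by_cases hdy : d y ≤ ε
  · simp only [F, if_pos hdy, G] at hy
    set w := projectionTransport P H m m (lam y, r y) (y - e (r y)) with hw
    have hPw : P (H (lam y, r y)) w = w := by
      have := projection_projectionTransport (h := H) (m := m) hPP m (lam y, r y) (y - e (r y))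
      rwa [truncatedTime_self hm] at this
    have hx : H (lam y, r y) = xq := huniq _ _ w 0 hPw (map_zero _)
      ((norm_projectionTransport_le hPn _ _ _).trans hdy) (by simp [hε.le]) (by simpa using hy)
    have hw0 : w = 0 := by
      rw [hx] at hy
      simpa using hy
    have hv0 : y - e (r y) = 0 := eq_zero_of_projectionTransport_eq_zero hPP hstep m
      (z := (lam y, r y)) (by simp only [hH0, hrP]) hw0
    have hd0 : d y = 0 := by simp only [d, hv0, norm_zero]
    have h1 : lam y = 1 := by
      simp only [lam, hd0, zero_div, sub_zero]
      exact projIcc_right zero_le_one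
    rw [h1] at hx
    exact hxq (hx.symm.trans (H.map_one_left _))
  · simp only [F, if_neg hdy] at hy
    have := hr y xq
    rw [← hy, sub_self, norm_zero] at this
    exact hdy (le_trans this hε.le)

end Tube

/-! ### Normal spaces of immersions: continuity and local uniqueness -/

section NormalProjection

open scoped RealInnerProductSpace

variable {W V : Type*} [NormedAddCommGroup W] [NormedSpace ℝ W] [FiniteDimensional ℝ W]
  [NormedAddCommGroup V] [InnerProductSpace ℝ V]

theorem ContinuousLinearMap.exists_pos_forall_mul_norm_le {A : W →L[ℝ] V}
    (hA : Function.Injective A) : ∃ c : ℝ, 0 < c ∧ ∀ w, c * ‖w‖ ≤ ‖A w‖ := by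
  obtain ⟨K, hK, hAK⟩ := (A : W →ₗ[ℝ] V).exists_antilipschitzWith (LinearMap.ker_eq_bot.2 hA)
  refine ⟨(K : ℝ)⁻¹, inv_pos.2 hK, fun w => ?_⟩
  have := hAK.le_mul_dist w 0
  rw [dist_zero_right, map_zero, dist_zero_right] at this
  rwa [inv_mul_le_iff₀ (NNReal.coe_pos.2 hK)]

/-- A vector of the range of `B` is some `B w`, and `1 - P` kills `A w`, so only `(B - A) w`
survives; the lower bound on `B` controls `‖w‖`. -/
theorem norm_one_sub_starProjection_mul_le {A B : W →L[ℝ] V} {c : ℝ} (hc : 0 < c)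
    (hB : ∀ w, c * ‖w‖ ≤ ‖B w‖) :
    ‖(1 - A.range.starProjection) * B.range.starProjection‖ ≤ ‖A - B‖ / c := by
  refine ContinuousLinearMap.opNorm_le_bound _ (by positivity) fun v => ?_
  obtain ⟨w, hw⟩ : B.range.starProjection v ∈ B.range :=
    Submodule.starProjection_apply_mem _ _
  have hw' : B w = B.range.starProjection v := hw
  have hAw : A.range.starProjection (A w) = A w :=
    Submodule.starProjection_eq_self_iff.2 ⟨w, rfl⟩
  have h1 : ((1 - A.range.starProjection) * B.range.starProjection) v =
      (1 - A.range.starProjection) ((B - A) w) := by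
    change (1 - A.range.starProjection) (B.range.starProjection v) = _
    rw [← hw']
    simp [hAw]
  have h2 : ‖(1 - A.range.starProjection) ((B - A) w)‖ ≤ ‖(B - A) w‖ := by
    rw [← Submodule.starProjection_orthogonal']
    exact Submodule.norm_starProjection_apply_le _ _
  have h3 : c * ‖w‖ ≤ ‖v‖ :=
    (hB w).trans (by rw [hw']; exact Submodule.norm_starProjection_apply_le _ _)
  rw [h1]
  refine h2.trans (((B - A).le_opNorm w).trans ?_)
  rw [norm_sub_rev, div_mul_eq_mul_div, mul_div_assoc]
  gcongr
  rwa [le_div_iff₀' hc]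

variable [FiniteDimensional ℝ V]

/-- The identity `P - Q = ((1 - Q) P)* - (1 - P) Q` reduces the estimate to two one-sided ones. -/
theorem norm_starProjection_range_sub_le {A B : W →L[ℝ] V} {c : ℝ} (hc : 0 < c)
    (hA : ∀ w, c * ‖w‖ ≤ ‖A w‖) (hB : ∀ w, c * ‖w‖ ≤ ‖B w‖) :
    ‖A.range.starProjection - B.range.starProjection‖ ≤ 2 * (‖A - B‖ / c) := by
  set P := A.range.starProjection
  set Q := B.range.starProjection
  have hP : star P = P := isSelfAdjoint_starProjection A.range
  have hQ : star Q = Q := isSelfAdjoint_starProjection B.range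
  have h1 : P - Q = star ((1 - Q) * P) - (1 - P) * Q := by
    rw [star_mul, star_sub, star_one, hP, hQ]
    noncomm_ring
  have h2 : ‖star ((1 - Q) * P)‖ ≤ ‖A - B‖ / c := by
    rw [ContinuousLinearMap.star_eq_adjoint, LinearIsometryEquiv.norm_map, norm_sub_rev A B]
    exact norm_one_sub_starProjection_mul_le hc hA
  calc ‖P - Q‖ ≤ ‖star ((1 - Q) * P)‖ + ‖(1 - P) * Q‖ := by rw [h1]; exact norm_sub_le _ _
    _ ≤ ‖A - B‖ / c + ‖A - B‖ / c :=
      add_le_add h2 (norm_one_sub_starProjection_mul_le hc hB)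
    _ = 2 * (‖A - B‖ / c) := by ring

theorem ContinuousAt.starProjection_range {X : Type*} [TopologicalSpace X] {A : X → W →L[ℝ] V}
    {x₀ : X} (hA : ContinuousAt A x₀) (hinj : Function.Injective (A x₀)) :
    ContinuousAt (fun x => (A x).range.starProjection) x₀ := by
  obtain ⟨c, hc, hcA⟩ := ContinuousLinearMap.exists_pos_forall_mul_norm_le hinj
  have hev : ∀ᶠ x in 𝓝 x₀, ‖A x - A x₀‖ < c / 2 := by
    have := hA.eventually (Metric.ball_mem_nhds (A x₀) (half_pos hc))
    simpa [dist_eq_norm] using this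
  have hlim : Tendsto (fun x => 2 * (‖A x - A x₀‖ / (c / 2))) (𝓝 x₀) (𝓝 0) := by
    have := ((tendsto_iff_norm_sub_tendsto_zero.1 hA).div_const (c / 2)).const_mul 2
    simpa using this
  refine tendsto_iff_norm_sub_tendsto_zero.2 (squeeze_zero' (Eventually.of_forall fun _ =>
    norm_nonneg _) ?_ hlim)
  filter_upwards [hev] with x hx
  refine norm_starProjection_range_sub_le (half_pos hc) (fun w => ?_) fun w => ?_
  · have h1 : ‖A x₀ w‖ ≤ ‖A x w‖ + ‖(A x - A x₀) w‖ := by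
      rw [sub_apply]
      exact norm_le_norm_add_norm_sub _ _
    have h2 := (A x - A x₀).le_of_opNorm_le hx.le w
    linarith [hcA w]
  · nlinarith [hcA w, norm_nonneg w]

omit [FiniteDimensional ℝ V] in
/-- Near a point where a `C²` map is an immersion, its normal spaces are orthogonal to its
increments up to second order. -/
theorem ContDiffAt.exists_abs_inner_le_sq {f : W → V} {a₀ : W} (hf : ContDiffAt ℝ 2 f a₀)
    (hinj : Function.Injective (fderiv ℝ f a₀)) :
    ∃ s ∈ 𝓝 a₀, ∃ C : ℝ, 0 < C ∧ ∀ a ∈ s, ∀ b ∈ s, ∀ v ∈ (fderiv ℝ f a).rangeᗮ,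
      |⟪v, f b - f a⟫| ≤ C * ‖v‖ * ‖f b - f a‖ ^ 2 := by
  obtain ⟨c, hc, hcA⟩ := ContinuousLinearMap.exists_pos_forall_mul_norm_le hinj
  obtain ⟨K, t, ht, hK⟩ := (hf.fderiv_right (m := 1) (by norm_num)).exists_lipschitzOnWith
  have hdiff : ∀ᶠ a in 𝓝 a₀, DifferentiableAt ℝ f a :=
    (hf.eventually (by simp)).mono fun a ha => ha.differentiableAt (by simp)
  obtain ⟨r₁, hr₁, hball⟩ := Metric.mem_nhds_iff.1 (inter_mem ht hdiff)
  -- The Taylor error costs `2 K r` and the change of derivative `K r`; together they leave half of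
  -- the lower bound `c`.
  set r := min r₁ (c / (6 * (K + 1)))
  have hr : 0 < r := lt_min hr₁ (by positivity)
  have hrK : 3 * K * r ≤ c / 2 := by
    have h1 : r ≤ c / (6 * (K + 1)) := min_le_right _ _
    rw [le_div_iff₀ (by positivity)] at h1
    nlinarith [K.coe_nonneg]
  have hsub : ∀ a ∈ Metric.ball a₀ r, a ∈ t ∧ DifferentiableAt ℝ f a := fun a ha =>
    hball (Metric.ball_subset_ball (min_le_left _ _) ha)
  have htaylor : ∀ a ∈ Metric.ball a₀ r, ∀ b ∈ Metric.ball a₀ r,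
      ‖f b - f a - fderiv ℝ f a (b - a)‖ ≤ K * ‖b - a‖ * ‖b - a‖ := by
    intro a ha b hb
    have hseg : segment ℝ a b ⊆ Metric.ball a₀ r := (convex_ball a₀ r).segment_subset ha hb
    refine Convex.norm_image_sub_le_of_norm_fderiv_le' (s := segment ℝ a b)
      (fun x hx => (hsub x (hseg hx)).2) (fun x hx => ?_) (convex_segment a b)
      (left_mem_segment ℝ a b) (right_mem_segment ℝ a b)
    refine (hK.norm_sub_le (hsub x (hseg hx)).1 (hsub a ha).1).trans ?_
    gcongr
    exact norm_sub_le_of_mem_segment hx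
  have hlow : ∀ a ∈ Metric.ball a₀ r, ∀ b ∈ Metric.ball a₀ r,
      c / 2 * ‖b - a‖ ≤ ‖f b - f a‖ := by
    intro a ha b hb
    have h1 := htaylor a ha b hb
    have h2 : ‖fderiv ℝ f a - fderiv ℝ f a₀‖ ≤ K * r := by
      refine (hK.norm_sub_le (hsub a ha).1 (hsub a₀ (Metric.mem_ball_self hr)).1).trans ?_
      gcongr
      exact (mem_ball_iff_norm.1 ha).le
    have h3 : ‖b - a‖ ≤ 2 * r := by
      rw [← dist_eq_norm]
      linarith [dist_triangle_right b a a₀, Metric.mem_ball.1 ha, Metric.mem_ball.1 hb]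
    have h4 := (fderiv ℝ f a - fderiv ℝ f a₀).le_of_opNorm_le h2 (b - a)
    have h5 : ‖fderiv ℝ f a₀ (b - a)‖ ≤ ‖f b - f a‖ + ‖f b - f a - fderiv ℝ f a (b - a)‖ +
        ‖(fderiv ℝ f a - fderiv ℝ f a₀) (b - a)‖ := by
      have : fderiv ℝ f a₀ (b - a) = (f b - f a) - (f b - f a - fderiv ℝ f a (b - a)) -
          (fderiv ℝ f a - fderiv ℝ f a₀) (b - a) := by
        rw [sub_apply]
        abel
      rw [this]
      exact (norm_sub_le _ _).trans (add_le_add_left (norm_sub_le _ _) _)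
    have h6 := hcA (b - a)
    have h7 : (K : ℝ) * ‖b - a‖ * ‖b - a‖ ≤ 2 * (K * r) * ‖b - a‖ := by
      have : (K : ℝ) * ‖b - a‖ ≤ 2 * (K * r) := by nlinarith [K.coe_nonneg]
      exact mul_le_mul_of_nonneg_right this (norm_nonneg _)
    nlinarith [norm_nonneg (b - a)]
  refine ⟨Metric.ball a₀ r, Metric.ball_mem_nhds _ hr, (K + 1) * (2 / c) ^ 2, by positivity,
    fun a ha b hb v hv => ?_⟩
  have h0 : ⟪v, fderiv ℝ f a (b - a)⟫ = 0 :=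
    Submodule.inner_left_of_mem_orthogonal (K := (fderiv ℝ f a).range) ⟨b - a, rfl⟩ hv
  have h1 : ⟪v, f b - f a⟫ = ⟪v, f b - f a - fderiv ℝ f a (b - a)⟫ := by
    rw [inner_sub_right _ (f b - f a), h0, sub_zero]
  have h2 : ‖b - a‖ ≤ 2 / c * ‖f b - f a‖ := by
    have := hlow a ha b hb
    rw [div_mul_eq_mul_div, le_div_iff₀ hc]
    linarith
  calc |⟪v, f b - f a⟫| ≤ ‖v‖ * ‖f b - f a - fderiv ℝ f a (b - a)‖ := by
        rw [h1]; exact abs_real_inner_le_norm _ _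
    _ ≤ ‖v‖ * (K * ‖b - a‖ * ‖b - a‖) := by gcongr; exact htaylor a ha b hb
    _ ≤ ‖v‖ * ((K + 1) * (2 / c * ‖f b - f a‖) * (2 / c * ‖f b - f a‖)) := by
        gcongr
        linarith
    _ = (K + 1) * (2 / c) ^ 2 * ‖v‖ * ‖f b - f a‖ ^ 2 := by ring

omit [FiniteDimensional ℝ V] in
/-- Near a point where a `C²` map is an immersion, short normal segments do not intersect. -/
theorem ContDiffAt.exists_normal_injective {f : W → V} {a₀ : W} (hf : ContDiffAt ℝ 2 f a₀)
    (hinj : Function.Injective (fderiv ℝ f a₀)) :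
    ∃ s ∈ 𝓝 a₀, ∃ ε : ℝ, 0 < ε ∧ ∀ a ∈ s, ∀ b ∈ s, ∀ v ∈ (fderiv ℝ f a).rangeᗮ,
      ∀ v' ∈ (fderiv ℝ f b).rangeᗮ, ‖v‖ ≤ ε → ‖v'‖ ≤ ε → f a + v = f b + v' → f a = f b := by
  obtain ⟨s, hs, C, hC, h⟩ := hf.exists_abs_inner_le_sq hinj
  -- Here `f b - f a = v - v'`. Each of its inner products with `v` and `v'` is at most a quarter of
  -- `‖v - v'‖ ^ 2`, which forces `v = v'`.
  refine ⟨s, hs, 1 / (4 * C), by positivity, fun a ha b hb v hv v' hv' hvε hvε' heq => ?_⟩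
  have h1 := h a ha b hb v hv
  have h2 := h b hb a ha v' hv'
  have hw : f b - f a = v - v' := by
    rw [sub_eq_sub_iff_add_eq_add, ← heq, add_comm]
  have hw' : f a - f b = -(v - v') := by rw [← hw, neg_sub]
  have h3 : ‖v - v'‖ ^ 2 = ⟪v, v - v'⟫ - ⟪v', v - v'⟫ := by
    rw [← inner_sub_left, real_inner_self_eq_norm_sq]
  rw [hw] at h1
  rw [hw', inner_neg_right, abs_neg, norm_neg] at h2
  have hCv : C * ‖v‖ ≤ 1 / 4 := by
    have : C * (1 / (4 * C)) = 1 / 4 := by field_simp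
    nlinarith
  have hCv' : C * ‖v'‖ ≤ 1 / 4 := by
    have : C * (1 / (4 * C)) = 1 / 4 := by field_simp
    nlinarith
  have h4 : ‖v - v'‖ ^ 2 ≤ 1 / 2 * ‖v - v'‖ ^ 2 := by
    have := le_abs_self ⟪v, v - v'⟫
    have := neg_abs_le ⟪v', v - v'⟫
    nlinarith [sq_nonneg ‖v - v'‖]
  have h5 : ‖v - v'‖ = 0 := by
    have : ‖v - v'‖ ^ 2 ≤ 0 := by linarith
    exact pow_eq_zero_iff two_ne_zero |>.1 (le_antisymm this (sq_nonneg _))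
  rw [norm_eq_zero, ← hw, sub_eq_zero] at h5
  exact h5.symm

end NormalProjection

/-! ### The tube around an embedded closed manifold -/

section ClosedManifold

open scoped RealInnerProductSpace

variable {n : ℕ} {M : Type*} [TopologicalSpace M] [ChartedSpace (EuclideanSpace ℝ (Fin n)) M]
  {V : Type*}

/-- The map `e` in the preferred chart at `x₀`. -/
noncomputable def writtenInChart (e : M → V) (x₀ : M) : EuclideanSpace ℝ (Fin n) → V :=
  e ∘ (extChartAt (𝓡 n) x₀).symm

theorem writtenInChart_extChartAt {e : M → V} {x₀ x : M} (hx : x ∈ (extChartAt (𝓡 n) x₀).source) :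
    writtenInChart (n := n) e x₀ (extChartAt (𝓡 n) x₀ x) = e x := by
  rw [writtenInChart, Function.comp_apply, (extChartAt (𝓡 n) x₀).left_inv hx]

variable [NormedAddCommGroup V] [InnerProductSpace ℝ V] {e : M → V}

/-- The derivative of `e` at `x`, as a linear map between vector spaces. -/
noncomputable def euclideanDeriv (n : ℕ) [ChartedSpace (EuclideanSpace ℝ (Fin n)) M]
    (e : M → V) (x : M) : EuclideanSpace ℝ (Fin n) →L[ℝ] V :=
  mfderiv (𝓡 n) 𝓘(ℝ, V) e x

/-- The orthogonal projection onto the normal space of the immersion `e` at `x`. -/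
noncomputable def normalProjection (n : ℕ) [ChartedSpace (EuclideanSpace ℝ (Fin n)) M]
    (e : M → V) (x : M) : V →L[ℝ] V :=
  (euclideanDeriv n e x).rangeᗮ.starProjection

theorem normalProjection_eq_self_iff {x : M} {v : V} : normalProjection n e x v = v ↔
    v ∈ (euclideanDeriv n e x).rangeᗮ :=
  Submodule.starProjection_eq_self_iff

variable [IsManifold (𝓡 n) ∞ M]

theorem contDiffAt_writtenInChart (he : ContMDiff (𝓡 n) 𝓘(ℝ, V) ∞ e) (x₀ : M)
    {a : EuclideanSpace ℝ (Fin n)} (ha : a ∈ (extChartAt (𝓡 n) x₀).target) :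
    ContDiffAt ℝ ∞ (writtenInChart (n := n) e x₀) a := by
  have h := he.comp_contMDiffOn (contMDiffOn_extChartAt_symm (I := 𝓡 n) (n := ∞) x₀)
  exact (contMDiffOn_iff_contDiffOn.1 h).contDiffAt
    ((isOpen_extChartAt_target (I := 𝓡 n) x₀).mem_nhds ha)

theorem mfderiv_eq_fderiv_writtenInChart_comp (he : ContMDiff (𝓡 n) 𝓘(ℝ, V) ∞ e) {x₀ x : M}
    (hx : x ∈ (extChartAt (𝓡 n) x₀).source) :
    mfderiv (𝓡 n) 𝓘(ℝ, V) e x =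
      (fderiv ℝ (writtenInChart (n := n) e x₀) (extChartAt (𝓡 n) x₀ x)).comp
        (mfderiv (𝓡 n) 𝓘(ℝ, EuclideanSpace ℝ (Fin n)) (extChartAt (𝓡 n) x₀) x) := by
  have h1 : e =ᶠ[𝓝 x] writtenInChart (n := n) e x₀ ∘ extChartAt (𝓡 n) x₀ := by
    filter_upwards [(isOpen_extChartAt_source (I := 𝓡 n) x₀).mem_nhds hx] with y hy
    exact (writtenInChart_extChartAt hy).symm
  have h2 : MDifferentiableAt 𝓘(ℝ, EuclideanSpace ℝ (Fin n)) 𝓘(ℝ, V)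
      (writtenInChart (n := n) e x₀) (extChartAt (𝓡 n) x₀ x) :=
    ((contDiffAt_writtenInChart he x₀ ((extChartAt (𝓡 n) x₀).map_source hx)).differentiableAt
      (by simp)).mdifferentiableAt
  have h3 : MDifferentiableAt (𝓡 n) 𝓘(ℝ, EuclideanSpace ℝ (Fin n)) (extChartAt (𝓡 n) x₀) x :=
    mdifferentiableAt_extChartAt (by rwa [extChartAt_source] at hx)
  rw [h1.mfderiv_eq, mfderiv_comp x h2 h3, mfderiv_eq_fderiv]
  rfl

theorem surjective_mfderiv_extChartAt {x₀ x : M} (hx : x ∈ (extChartAt (𝓡 n) x₀).source) :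
    Function.Surjective
      (mfderiv (𝓡 n) 𝓘(ℝ, EuclideanSpace ℝ (Fin n)) (extChartAt (𝓡 n) x₀) x) := by
  have : IsManifold (𝓡 n) 1 M := .of_le (n := ∞) (by simp)
  obtain ⟨L, hL⟩ := isInvertible_mfderiv_extChartAt (I := 𝓡 n) hx
  rw [← hL]
  exact L.surjective

/-- Expresses nearby tangent spaces in one fixed chart, so that the vector-space results above
apply. -/
theorem range_euclideanDeriv (he : ContMDiff (𝓡 n) 𝓘(ℝ, V) ∞ e) {x₀ x : M}
    (hx : x ∈ (extChartAt (𝓡 n) x₀).source) :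
    (euclideanDeriv n e x).range =
      (fderiv ℝ (writtenInChart (n := n) e x₀) (extChartAt (𝓡 n) x₀ x)).range := by
  rw [euclideanDeriv, mfderiv_eq_fderiv_writtenInChart_comp he hx]
  exact LinearMap.range_comp_of_range_eq_top _
    (LinearMap.range_eq_top.2 (surjective_mfderiv_extChartAt hx))

theorem injective_fderiv_writtenInChart (he : ContMDiff (𝓡 n) 𝓘(ℝ, V) ∞ e) {x₀ x : M}
    (hx : x ∈ (extChartAt (𝓡 n) x₀).source)
    (hinj : Function.Injective (mfderiv (𝓡 n) 𝓘(ℝ, V) e x)) :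
    Function.Injective (fderiv ℝ (writtenInChart (n := n) e x₀) (extChartAt (𝓡 n) x₀ x)) := by
  intro w w' hw
  obtain ⟨u, rfl⟩ := surjective_mfderiv_extChartAt (n := n) hx w
  obtain ⟨u', rfl⟩ := surjective_mfderiv_extChartAt (n := n) hx w'
  have h := mfderiv_eq_fderiv_writtenInChart_comp he hx
  have : mfderiv (𝓡 n) 𝓘(ℝ, V) e x u = mfderiv (𝓡 n) 𝓘(ℝ, V) e x u' := by
    rw [h]
    exact hw
  rw [hinj this]

/-- Compactness of `M × M` reduces this to a neighbourhood of each pair. At a diagonal pair the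
local immersion result applies; at any other, the images are a positive distance apart, too far for
short normals to meet. -/
theorem exists_normal_injective [CompactSpace M] (he : ContMDiff (𝓡 n) 𝓘(ℝ, V) ∞ e)
    (hei : Function.Injective e) (hinj : ∀ x, Function.Injective (mfderiv (𝓡 n) 𝓘(ℝ, V) e x)) :
    ∃ ε : ℝ, 0 < ε ∧ ∀ x x' v v', normalProjection n e x v = v → normalProjection n e x' v' = v' →
      ‖v‖ ≤ ε → ‖v'‖ ≤ ε → e x + v = e x' + v' → x = x' := by
  have key : ∀ᶠ ε in 𝓝 (0 : ℝ), ∀ z ∈ (univ : Set (M × M)), ∀ v v',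
      normalProjection n e z.1 v = v → normalProjection n e z.2 v' = v' →
      ‖v‖ ≤ ε → ‖v'‖ ≤ ε → e z.1 + v = e z.2 + v' → z.1 = z.2 := by
    refine isCompact_univ.eventually_forall_of_forall_eventually fun ⟨x₀, x₀'⟩ _ => ?_
    by_cases hx : x₀ = x₀'
    · subst hx
      have hsrc := mem_extChartAt_source (I := 𝓡 n) x₀
      obtain ⟨s, hs, ε, hε, h⟩ := ((contDiffAt_writtenInChart he x₀
        ((extChartAt (𝓡 n) x₀).map_source hsrc)).of_le
          (by norm_cast)).exists_normal_injective
        (injective_fderiv_writtenInChart he hsrc (hinj x₀))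
      have hU : (extChartAt (𝓡 n) x₀) ⁻¹' s ∩ (extChartAt (𝓡 n) x₀).source ∈ 𝓝 x₀ :=
        inter_mem ((continuousAt_extChartAt x₀).preimage_mem_nhds hs)
          (extChartAt_source_mem_nhds x₀)
      filter_upwards [prod_mem_nhds (Iio_mem_nhds hε) (prod_mem_nhds hU hU)]
      rintro ⟨δ, x, x'⟩ ⟨hδ, hx, hx'⟩ v v' hv hv' hvδ hvδ' heq
      rw [normalProjection_eq_self_iff, range_euclideanDeriv he hx.2] at hv
      rw [normalProjection_eq_self_iff, range_euclideanDeriv he hx'.2] at hv'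
      have := h _ hx.1 _ hx'.1 v hv v' hv' (hvδ.trans (le_of_lt hδ)) (hvδ'.trans (le_of_lt hδ))
        (by rwa [writtenInChart_extChartAt hx.2, writtenInChart_extChartAt hx'.2])
      rw [writtenInChart_extChartAt hx.2, writtenInChart_extChartAt hx'.2] at this
      exact hei this
    · have hpos : 2 * (0 : ℝ) < ‖e x₀ - e x₀'‖ := by
        rw [mul_zero, norm_pos_iff, sub_ne_zero]
        exact fun h => hx (hei h)
      have hc := he.continuous
      have hev : ∀ᶠ z : ℝ × (M × M) in 𝓝 (0, (x₀, x₀')), 2 * z.1 < ‖e z.2.1 - e z.2.2‖ :=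
        ContinuousAt.eventually_lt (f := fun z : ℝ × (M × M) => 2 * z.1)
          (g := fun z : ℝ × (M × M) => ‖e z.2.1 - e z.2.2‖)
          (by fun_prop) (by fun_prop) hpos
      filter_upwards [hev]
      rintro ⟨δ, x, x'⟩ hδ v v' - - hvδ hvδ' heq
      exfalso
      have h1 : e x - e x' = v' - v := by
        rw [sub_eq_sub_iff_add_eq_add, heq, add_comm]
      simp only at hδ hvδ hvδ'
      rw [h1] at hδ
      linarith [norm_sub_le v' v]
  obtain ⟨r, hr, h⟩ := Metric.eventually_nhds_iff.1 key
  refine ⟨r / 2, half_pos hr, fun x x' => h (y := r / 2) ?_ (x, x') (mem_univ _)⟩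
  rw [Real.dist_0_eq_abs, abs_of_pos (half_pos hr)]
  exact half_lt_self hr

/-- The squared distance to `y` is critical at a nearest point, so `y - e x` is orthogonal to the
tangent space. -/
theorem normalProjection_sub_of_isMin (he : ContMDiff (𝓡 n) 𝓘(ℝ, V) ∞ e) {x : M} {y : V}
    (hx : ∀ x', ‖y - e x‖ ≤ ‖y - e x'‖) : normalProjection n e x (y - e x) = y - e x := by
  have hsrc := mem_extChartAt_source (I := 𝓡 n) x
  rw [normalProjection_eq_self_iff, range_euclideanDeriv he hsrc]
  set f := writtenInChart (n := n) e x
  set a := extChartAt (𝓡 n) x x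
  have hfa : f a = e x := writtenInChart_extChartAt hsrc
  have hd : HasFDerivAt f (fderiv ℝ f a) a :=
    ((contDiffAt_writtenInChart he x ((extChartAt (𝓡 n) x).map_source hsrc)).differentiableAt
      (by simp)).hasFDerivAt
  have h1 := (hd.const_sub y).norm_sq
  have hmin : IsLocalMin (fun b => ‖y - f b‖ ^ 2) a := by
    refine Eventually.of_forall fun b => ?_
    change ‖y - f a‖ ^ 2 ≤ ‖y - f b‖ ^ 2
    rw [hfa]
    exact pow_le_pow_left₀ (norm_nonneg _) (hx _) 2
  have h2 := hmin.hasFDerivAt_eq_zero h1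
  rw [Submodule.mem_orthogonal']
  rintro _ ⟨w, rfl⟩
  have h3 := congrArg (fun A => A w) h2
  rw [hfa] at h3
  have h4 : ⟪e x, fderiv ℝ f a w⟫ - ⟪y, fderiv ℝ f a w⟫ = 0 := by
    simpa [inner_sub_left] using h3
  change ⟪y - e x, fderiv ℝ f a w⟫ = 0
  rw [inner_sub_left]
  linarith

variable [FiniteDimensional ℝ V]

theorem continuous_normalProjection (he : ContMDiff (𝓡 n) 𝓘(ℝ, V) ∞ e)
    (hinj : ∀ x, Function.Injective (mfderiv (𝓡 n) 𝓘(ℝ, V) e x)) :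
    Continuous (normalProjection n e) := by
  refine continuous_iff_continuousAt.2 fun x₀ => ?_
  have hsrc := mem_extChartAt_source (I := 𝓡 n) x₀
  have h1 : ContinuousAt (fun x => fderiv ℝ (writtenInChart (n := n) e x₀)
      (extChartAt (𝓡 n) x₀ x)) x₀ :=
    ContinuousAt.comp (f := extChartAt (𝓡 n) x₀)
      (((contDiffAt_writtenInChart he x₀ ((extChartAt (𝓡 n) x₀).map_source hsrc)).fderiv_right
        (m := 0) (by simp)).continuousAt) (continuousAt_extChartAt x₀)
  have h2 := (continuousAt_const (y := (1 : V →L[ℝ] V))).sub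
    (h1.starProjection_range (injective_fderiv_writtenInChart he hsrc (hinj x₀)))
  refine h2.congr ?_
  filter_upwards [extChartAt_source_mem_nhds (I := 𝓡 n) x₀] with x hx
  simp only [normalProjection, range_euclideanDeriv he hx, Submodule.starProjection_orthogonal']
  rfl

/-- A closed smooth manifold that is not a point is not contractible. -/
theorem not_nullhomotopic_id_of_closed_manifold (n : ℕ) (M : Type*) [TopologicalSpace M]
    [ChartedSpace (EuclideanSpace ℝ (Fin n)) M] [IsManifold (𝓡 n) ∞ M] [T2Space M]
    [CompactSpace M] [Nontrivial M] : ¬ (ContinuousMap.id M).Nullhomotopic := by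
  obtain ⟨N, e, he, hemb, hinj⟩ := exists_embedding_euclidean_of_compact (I := 𝓡 n) (M := M)
  obtain ⟨ε, hε, huniq⟩ := exists_normal_injective he hemb.injective hinj
  exact not_nullhomotopic_id_of_tube he.continuous (continuous_normalProjection he hinj)
    (fun x v => Submodule.norm_starProjection_apply_le _ v)
    (fun x v => normalProjection_eq_self_iff.2 (Submodule.starProjection_apply_mem _ v))
    (fun x y => normalProjection_sub_of_isMin he) hε huniq

end ClosedManifold

/-! ### Local estimates for forward trajectories -/

section ForwardFlow

variable {FE HE E : Type*} [NormedAddCommGroup FE] [NormedSpace ℝ FE]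
  [TopologicalSpace HE] {IE : ModelWithCorners ℝ FE HE}
  [TopologicalSpace E] [ChartedSpace HE E] [IsManifold IE 1 E]
  {v : (z : E) → TangentSpace IE z}

/-- The vector field `v` in the preferred chart at `z₀`. -/
noncomputable def vectorFieldInChart (v : (z : E) → TangentSpace IE z) (z₀ : E) : FE → FE := fun a =>
  tangentCoordChange IE ((extChartAt IE z₀).symm a) z₀ ((extChartAt IE z₀).symm a)
    (v ((extChartAt IE z₀).symm a))

theorem IsMIntegralCurveOn.hasDerivWithinAt_extChartAt {γ : ℝ → E} {s : Set ℝ}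
    (hγ : IsMIntegralCurveOn (I := IE) γ v s) {t : ℝ} (ht : t ∈ s) {z₀ : E}
    (hsrc : γ t ∈ (extChartAt IE z₀).source) :
    HasDerivWithinAt (extChartAt IE z₀ ∘ γ)
      (vectorFieldInChart v z₀ (extChartAt IE z₀ (γ t))) s t := by
  have hval : vectorFieldInChart v z₀ (extChartAt IE z₀ (γ t)) =
      tangentCoordChange IE (γ t) z₀ (γ t) (v (γ t)) :=
    congrArg (fun z => (tangentCoordChange IE z z₀ z (v z) : FE)) ((extChartAt IE z₀).left_inv hsrc)
  set u := vectorFieldInChart v z₀ (extChartAt IE z₀ (γ t))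
  replace hsrc := extChartAt_source IE z₀ ▸ hsrc
  have h : HasMFDerivWithinAt 𝓘(ℝ, ℝ) 𝓘(ℝ, FE) (extChartAt IE z₀ ∘ γ) s t
      (ContinuousLinearMap.toSpanSingleton ℝ u : ℝ →L[ℝ] FE) := by
    refine (HasMFDerivWithinAt.comp t (hasMFDerivWithinAt_extChartAt (I := IE) hsrc) (hγ _ ht)
      (Set.subset_preimage_image _ _)).congr_mfderiv (ContinuousLinearMap.ext fun a => ?_)
    rw [mfderiv_chartAt_eq_tangentCoordChange hsrc]
    have key : ∀ (r : ℝ) (w : FE), tangentCoordChange IE (γ t) z₀ (γ t) (r • w) =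
        r • tangentCoordChange IE (γ t) z₀ (γ t) w := fun r w => map_smul _ r w
    exact (key a (v (γ t))).trans (congrArg (fun w : FE => (show ℝ from a) • w) hval.symm)
  exact hasDerivWithinAt_iff_hasFDerivWithinAt.2 (hasMFDerivWithinAt_iff_hasFDerivWithinAt.1 h)

theorem contDiffWithinAt_vectorFieldInChart
    (hv : ContMDiff IE IE.tangent 1 (fun z : E => (⟨z, v z⟩ : TangentBundle IE E))) (z₀ : E) :
    ContDiffWithinAt ℝ 1 (vectorFieldInChart v z₀) (range IE) (extChartAt IE z₀ z₀) :=
  (contMDiffAt_iff.1 (hv z₀)).2.snd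

/-- Local control of the forward trajectories of a `C¹` vector field, possibly on a manifold with
boundary: for a uniform time, trajectories starting near `z₀` stay in the chart and depend in a
Lipschitz way on the starting point. -/
theorem exists_forall_isMIntegralCurveOn_dist_le [FiniteDimensional ℝ FE] [T2Space E]
    (hv : ContMDiff IE IE.tangent 1 (fun z : E => (⟨z, v z⟩ : TangentBundle IE E))) (z₀ : E) :
    ∃ O : Set E, IsOpen O ∧ z₀ ∈ O ∧ ∃ δ : ℝ, 0 < δ ∧ ∃ C : ℝ,
      (∀ γ, IsMIntegralCurveOn (I := IE) γ v (Ici 0) → γ 0 ∈ O → ∀ t ∈ Icc 0 δ,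
        γ t ∈ (extChartAt IE z₀).source) ∧
      ∀ γ γ', IsMIntegralCurveOn (I := IE) γ v (Ici 0) → IsMIntegralCurveOn (I := IE) γ' v (Ici 0) →
        γ 0 ∈ O → γ' 0 ∈ O → ∀ t ∈ Icc 0 δ,
        dist (extChartAt IE z₀ (γ t)) (extChartAt IE z₀ (γ' t)) ≤
          dist (extChartAt IE z₀ (γ 0)) (extChartAt IE z₀ (γ' 0)) * C := by
  set χ := extChartAt IE z₀
  set c := χ z₀
  set w := vectorFieldInChart v z₀
  obtain ⟨K, T, hT, hK⟩ := (contDiffWithinAt_vectorFieldInChart hv z₀).exists_lipschitzOnWith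
    IE.convex_range
  obtain ⟨R, hR, hball⟩ := Metric.mem_nhdsWithin_iff.1
    (inter_mem hT (extChartAt_target_mem_nhdsWithin (I := IE) z₀))
  set s := Metric.ball c R ∩ range IE
  obtain ⟨hsT, hst⟩ : s ⊆ T ∧ s ⊆ χ.target := subset_inter_iff.1 hball
  have hwK : LipschitzOnWith K w s := hK.mono hsT
  have hcs : c ∈ s := ⟨Metric.mem_ball_self hR, mem_range_self _⟩
  -- A positive speed bound on `s`. Over time `δ = R / (4 L)` a trajectory drifts by at most `R /
  -- 4`, so from the ball of radius `R / 4` it stays within `R / 2`.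
  set L : ℝ := ‖w c‖ + K * R + 1
  have hL : 0 < L := by positivity
  have hwL : ∀ a ∈ s, ‖w a‖ ≤ L := by
    intro a ha
    have h1 := hwK.norm_sub_le ha hcs
    have h2 : ‖a - c‖ ≤ R := (mem_ball_iff_norm.1 ha.1).le
    have h3 : (K : ℝ) * ‖a - c‖ ≤ K * R := by gcongr
    have h4 := norm_le_norm_add_norm_sub' (w a) (w c)
    simp only [L]
    linarith
  set δ := R / (4 * L)
  have hδ : 0 < δ := by positivity
  have hLδ : L * δ = R / 4 := by simp only [δ]; field_simp
  set O : Set E := χ.source ∩ χ ⁻¹' Metric.ball c (R / 4)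
  have hO : IsOpen O := isOpen_extChartAt_preimage' z₀ Metric.isOpen_ball
  set U : Set E := χ.source ∩ χ ⁻¹' Metric.ball c R
  have hU : IsOpen U := isOpen_extChartAt_preimage' z₀ Metric.isOpen_ball
  have hUs : ∀ z ∈ U, χ z ∈ s := fun z hz =>
    ⟨hz.2, extChartAt_target_subset_range z₀ (χ.map_source hz.1)⟩
  -- A compact, hence closed, set inside the open set `U`: closedness feeds the continuation
  -- argument, and `U` leaves room to move on.
  set A : Set E := χ.symm '' (Metric.closedBall c (R / 2) ∩ range IE)
  have hAs : Metric.closedBall c (R / 2) ∩ range IE ⊆ s :=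
    inter_subset_inter_left _ (Metric.closedBall_subset_ball (half_lt_self hR))
  have hA : IsClosed A := by
    refine IsCompact.isClosed (IsCompact.image_of_continuousOn ?_
      ((continuousOn_extChartAt_symm z₀).mono (hAs.trans hst)))
    exact (isCompact_closedBall c (R / 2)).inter_right IE.isClosed_range
  have hAU : A ⊆ U := by
    rintro _ ⟨a, ha, rfl⟩
    refine ⟨χ.map_target (hst (hAs ha)), ?_⟩
    rw [mem_preimage, χ.right_inv (hst (hAs ha))]
    exact (hAs ha).1
  have hstay : ∀ γ, IsMIntegralCurveOn (I := IE) γ v (Ici 0) → γ 0 ∈ O →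
      ∀ t ∈ Icc 0 δ, γ t ∈ U := by
    intro γ hγ hγ0
    have hcont : ContinuousOn γ (Icc 0 δ) := hγ.continuousOn.mono Icc_subset_Ici_self
    have hclosed1 : IsClosed (Icc 0 δ ∩ γ ⁻¹' A) := hcont.preimage_isClosed_of_isClosed
      isClosed_Icc hA
    have hχγ : ContinuousOn (χ ∘ γ) (Icc 0 δ ∩ γ ⁻¹' A) :=
      (continuousOn_extChartAt z₀).comp (hcont.mono inter_subset_left)
        fun t ht => (hAU ht.2).1
    have hclosed : IsClosed ((Icc 0 δ ∩ γ ⁻¹' A) ∩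
        {t | ‖(χ ∘ γ) t - χ (γ 0)‖ - L * t ≤ 0}) := by
      have : ContinuousOn (fun t => ‖(χ ∘ γ) t - χ (γ 0)‖ - L * t) (Icc 0 δ ∩ γ ⁻¹' A) :=
        (hχγ.sub continuousOn_const).norm.sub (by fun_prop)
      exact this.preimage_isClosed_of_isClosed hclosed1 isClosed_Iic
    have hmemA : ∀ t ∈ Icc 0 δ, γ t ∈ U → ‖χ (γ t) - χ (γ 0)‖ ≤ L * t → γ t ∈ A := by
      intro t ht hU' h
      refine ⟨χ (γ t), ⟨?_, (hUs _ hU').2⟩, χ.left_inv hU'.1⟩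
      have h1 : dist (χ (γ 0)) c < R / 4 := hγ0.2
      have h2 : L * t ≤ R / 4 := hLδ ▸ mul_le_mul_of_nonneg_left ht.2 hL.le
      have h3 := dist_triangle (χ (γ t)) (χ (γ 0)) c
      rw [← dist_eq_norm] at h
      rw [Metric.mem_closedBall]
      linarith
    have hOU : O ⊆ U := fun z hz => ⟨hz.1, Metric.ball_subset_ball (by linarith) hz.2⟩
    -- Continuation: from a good time the curve remains in `U` a little longer, where the speed
    -- bound extends the drift estimate, which puts it back in `A`.
    have hsub : Icc 0 δ ⊆ {t | γ t ∈ A ∧ ‖(χ ∘ γ) t - χ (γ 0)‖ - L * t ≤ 0} := by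
      refine IsClosed.Icc_subset_of_forall_exists_gt ?_ ?_ ?_
      · convert hclosed using 1
        ext t
        simp only [mem_inter_iff, mem_ofPred_eq, mem_preimage]
        tauto
      · refine ⟨hmemA 0 ⟨le_rfl, hδ.le⟩ (hOU hγ0) (by simp), by simp⟩
      · rintro t ⟨⟨htA, htL⟩, ht⟩ y hy
        have hev : ∀ᶠ t' in 𝓝[Ici t] t, γ t' ∈ U :=
          ((hγ.continuousOn t ht.1).mono (Ici_subset_Ici.2 ht.1)).eventually
            (hU.mem_nhds (hAU htA))
        obtain ⟨η, hη, hηU⟩ := Metric.mem_nhdsWithin_iff.1 hev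
        set t' := min (min y δ) (t + η / 2)
        have htt' : t < t' := lt_min (lt_min hy ht.2) (by linarith)
        have ht'y : t' ≤ y := (min_le_left _ _).trans (min_le_left _ _)
        have ht'δ : t' ≤ δ := (min_le_left _ _).trans (min_le_right _ _)
        have hseg : ∀ u ∈ Icc t t', γ u ∈ U := fun u hu => hηU
          ⟨by
            rw [Metric.mem_ball, Real.dist_eq, abs_of_nonneg (sub_nonneg.2 hu.1)]
            linarith [hu.2.trans (min_le_right _ _)], hu.1⟩
        have hder : ∀ u ∈ Icc t t', HasDerivWithinAt (χ ∘ γ) (w (χ (γ u))) (Ici 0) u :=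
          fun u hu => hγ.hasDerivWithinAt_extChartAt (ht.1.trans hu.1) (hseg u hu).1
        have hmv := norm_image_sub_le_of_norm_deriv_right_le_segment (f := χ ∘ γ)
          (f' := fun u => w (χ (γ u))) (C := L) (a := t) (b := t')
          (fun u hu => (hder u hu).continuousWithinAt.mono
            fun r hr => ht.1.trans hr.1)
          (fun u hu => (hder u (Ico_subset_Icc_self hu)).mono
            (Ici_subset_Ici.2 (ht.1.trans hu.1)))
          (fun u hu => hwL _ (hUs _ (hseg u (Ico_subset_Icc_self hu)))) t' ⟨htt'.le, le_rfl⟩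
        have hbound : ‖(χ ∘ γ) t' - χ (γ 0)‖ ≤ L * t' := by
          have := norm_sub_le_norm_sub_add_norm_sub ((χ ∘ γ) t') ((χ ∘ γ) t) (χ (γ 0))
          linarith
        exact ⟨t', ⟨hmemA t' ⟨ht.1.trans htt'.le, ht'δ⟩ (hseg t' ⟨htt'.le, le_rfl⟩) hbound,
          sub_nonpos.2 hbound⟩, htt', ht'y⟩
    exact fun t ht => hAU (hsub ht).1
  refine ⟨O, hO, ⟨mem_extChartAt_source z₀, Metric.mem_ball_self (by positivity)⟩, δ, hδ,
    Real.exp (K * δ), fun γ hγ hγ0 t ht => (hstay γ hγ hγ0 t ht).1,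
    fun γ γ' hγ hγ' hγ0 hγ0' t ht => ?_⟩
  have hder : ∀ {γ}, IsMIntegralCurveOn (I := IE) γ v (Ici 0) → γ 0 ∈ O →
      ∀ u ∈ Icc 0 δ, HasDerivWithinAt (χ ∘ γ) (w (χ (γ u))) (Ici 0) u :=
    fun hγ hγ0 u hu => hγ.hasDerivWithinAt_extChartAt hu.1 (hstay _ hγ hγ0 u hu).1
  have hgron := dist_le_of_trajectories_ODE_of_mem (v := fun _ => w) (s := fun _ => s)
    (K := K) (f := χ ∘ γ) (g := χ ∘ γ') (a := 0) (b := δ) (fun _ _ => hwK)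
    (fun u hu => (hder hγ hγ0 u hu).continuousWithinAt.mono Icc_subset_Ici_self)
    (fun u hu => (hder hγ hγ0 u (Ico_subset_Icc_self hu)).mono (Ici_subset_Ici.2 hu.1))
    (fun u hu => hUs _ (hstay γ hγ hγ0 u (Ico_subset_Icc_self hu)))
    (fun u hu => (hder hγ' hγ0' u hu).continuousWithinAt.mono Icc_subset_Ici_self)
    (fun u hu => (hder hγ' hγ0' u (Ico_subset_Icc_self hu)).mono (Ici_subset_Ici.2 hu.1))
    (fun u hu => hUs _ (hstay γ' hγ' hγ0' u (Ico_subset_Icc_self hu))) le_rfl t ht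
  refine hgron.trans ?_
  simp only [Function.comp_apply, sub_zero]
  gcongr
  exact ht.2

end ForwardFlow

/-! ### Uniqueness and joint continuity of the forward flow -/

section ForwardFlowContinuity

variable {FE HE E : Type*} [NormedAddCommGroup FE] [NormedSpace ℝ FE]
  [TopologicalSpace HE] {IE : ModelWithCorners ℝ FE HE}
  [TopologicalSpace E] [ChartedSpace HE E]
  {v : (z : E) → TangentSpace IE z} {S : Set E}

theorem IsForwardSolutionIn.comp_add {γ : ℝ → E} (hγ : IsForwardSolutionIn IE v S γ) {s : ℝ}
    (hs : 0 ≤ s) : IsForwardSolutionIn IE v S (γ ∘ (· + s)) :=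
  ⟨(hγ.1.comp_add s).mono fun _ ht => add_nonneg ht hs, fun _ ht => hγ.2 _ (add_nonneg ht hs)⟩

variable [IsManifold IE 1 E] [FiniteDimensional ℝ FE] [T2Space E]

/-- Forward solutions are determined by their starting points. -/
theorem IsForwardSolutionIn.eqOn
    (hv : ContMDiff IE IE.tangent 1 (fun z : E => (⟨z, v z⟩ : TangentBundle IE E)))
    {γ γ' : ℝ → E} (hγ : IsForwardSolutionIn IE v S γ) (hγ' : IsForwardSolutionIn IE v S γ')
    (h0 : γ 0 = γ' 0) : EqOn γ γ' (Ici 0) := by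
  intro T hT
  have hsub : Icc 0 T ⊆ {t | γ t = γ' t} := by
    refine IsClosed.Icc_subset_of_forall_exists_gt ?_ h0 ?_
    · have h1 : ContinuousOn (fun t => (γ t, γ' t)) (Icc 0 T) :=
        (hγ.1.continuousOn.prodMk hγ'.1.continuousOn).mono Icc_subset_Ici_self
      rw [inter_comm]
      exact h1.preimage_isClosed_of_isClosed isClosed_Icc isClosed_diagonal
    · rintro t ⟨ht, htT⟩ y hy
      obtain ⟨O, -, hO, δ, hδ, C, hsrc, hdist⟩ :=
        exists_forall_isMIntegralCurveOn_dist_le hv (γ t)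
      have ht' : γ t = γ' t := ht
      have h1 : (γ ∘ (· + t)) 0 ∈ O := by simpa using hO
      have h2 : (γ' ∘ (· + t)) 0 ∈ O := by simpa [← ht'] using hO
      set u := min δ (y - t)
      have hu : 0 < u := lt_min hδ (sub_pos.2 hy)
      have huδ : u ∈ Icc 0 δ := ⟨hu.le, min_le_left _ _⟩
      have h3 := hdist _ _ (hγ.comp_add htT.1).1 (hγ'.comp_add htT.1).1 h1 h2 u huδ
      have h4 : dist (extChartAt IE (γ t) ((γ ∘ (· + t)) 0))
          (extChartAt IE (γ t) ((γ' ∘ (· + t)) 0)) = 0 := by simp [← ht']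
      rw [h4, zero_mul] at h3
      have h5 := (extChartAt IE (γ t)).injOn (hsrc _ (hγ.comp_add htT.1).1 h1 u huδ)
        (hsrc _ (hγ'.comp_add htT.1).1 h2 u huδ) (dist_le_zero.1 h3)
      refine ⟨u + t, h5, by linarith, ?_⟩
      linarith [min_le_right δ (y - t)]
  exact hsub ⟨hT, le_rfl⟩

variable {φ : E → ℝ → E}

theorem IsForwardSolutionIn.flow_add
    (hv : ContMDiff IE IE.tangent 1 (fun z : E => (⟨z, v z⟩ : TangentBundle IE E)))
    (hφ0 : ∀ z ∈ S, φ z 0 = z) (hφ : ∀ z ∈ S, IsForwardSolutionIn IE v S (φ z)) {z : E}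
    (hz : z ∈ S) {s t : ℝ} (hs : 0 ≤ s) (ht : 0 ≤ t) : φ z (t + s) = φ (φ z s) t := by
  have hzs := (hφ z hz).2 s hs
  exact ((hφ z hz).comp_add hs).eqOn hv (hφ _ hzs) (by simp [hφ0 _ hzs]) ht

/-- In the chart, the flow is Lipschitz in the starting point uniformly in time and continuous in
time for each starting point; together these give joint continuity. -/
theorem exists_eventually_continuousOn_flow
    (hv : ContMDiff IE IE.tangent 1 (fun z : E => (⟨z, v z⟩ : TangentBundle IE E)))
    (hφ0 : ∀ z ∈ S, φ z 0 = z) (hφ : ∀ z ∈ S, IsForwardSolutionIn IE v S (φ z)) (z₀ : E) :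
    ∃ O ∈ 𝓝 z₀, ∃ δ : ℝ, 0 < δ ∧
      ContinuousOn (fun q : ℝ × E => φ q.2 q.1) (Icc 0 δ ×ˢ (O ∩ S)) := by
  obtain ⟨O, hO, hzO, δ, hδ, C, hsrc, hdist⟩ := exists_forall_isMIntegralCurveOn_dist_le hv z₀
  have hOsrc : ∀ z ∈ O ∩ S, z ∈ (extChartAt IE z₀).source := fun z hz => by
    have := hsrc _ (hφ z hz.2).1 (by rw [hφ0 z hz.2]; exact hz.1) 0 ⟨le_rfl, hδ.le⟩
    rwa [hφ0 z hz.2] at this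
  refine ⟨O, hO.mem_nhds hzO, δ, hδ, ?_⟩
  set D := Icc 0 δ ×ˢ (O ∩ S)
  have hsrcD : ∀ q ∈ D, φ q.2 q.1 ∈ (extChartAt IE z₀).source := fun q hq =>
    hsrc _ (hφ q.2 hq.2.2).1 (by rw [hφ0 _ hq.2.2]; exact hq.2.1) q.1 hq.1
  have hchart : ContinuousOn (fun q : ℝ × E => extChartAt IE z₀ (φ q.2 q.1)) D := by
    rintro ⟨t₁, z₁⟩ ⟨ht₁, hz₁⟩
    have h1 : Tendsto (fun q : ℝ × E => dist (extChartAt IE z₀ q.2) (extChartAt IE z₀ z₁) * C)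
        (𝓝[D] (t₁, z₁)) (𝓝 0) := by
      have hc : ContinuousAt (fun q : ℝ × E => extChartAt IE z₀ q.2) (t₁, z₁) :=
        ContinuousAt.comp (f := Prod.snd) (continuousAt_extChartAt' (hOsrc z₁ hz₁))
          continuousAt_snd
      have := (tendsto_iff_dist_tendsto_zero.1 hc.tendsto).mul_const C
      rw [zero_mul] at this
      exact this.mono_left nhdsWithin_le_nhds
    have h2 : Tendsto (fun q : ℝ × E => dist (extChartAt IE z₀ (φ z₁ q.1))
        (extChartAt IE z₀ (φ z₁ t₁))) (𝓝[D] (t₁, z₁)) (𝓝 0) := by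
      have hc : ContinuousWithinAt (fun t => extChartAt IE z₀ (φ z₁ t)) (Icc 0 δ) t₁ :=
        (continuousAt_extChartAt' (hsrcD (t₁, z₁) ⟨ht₁, hz₁⟩)).comp_continuousWithinAt
          (((hφ z₁ hz₁.2).1.continuousOn t₁ ht₁.1).mono Icc_subset_Ici_self)
      have hc' : Tendsto (fun q : ℝ × E => q.1) (𝓝[D] (t₁, z₁)) (𝓝[Icc 0 δ] t₁) :=
        tendsto_nhdsWithin_iff.2 ⟨continuous_fst.continuousAt.mono_left nhdsWithin_le_nhds,
          eventually_mem_nhdsWithin.mono fun q hq => hq.1⟩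
      exact tendsto_iff_dist_tendsto_zero.1 (hc.tendsto.comp hc')
    refine tendsto_iff_dist_tendsto_zero.2 (squeeze_zero' (Eventually.of_forall fun _ =>
      dist_nonneg) ?_ (by simpa using h1.add h2))
    filter_upwards [eventually_mem_nhdsWithin] with q hq
    refine (dist_triangle _ (extChartAt IE z₀ (φ z₁ q.1)) _).trans (add_le_add_left ?_ _)
    have := hdist (φ q.2) (φ z₁) (hφ _ hq.2.2).1 (hφ _ hz₁.2).1
      (by rw [hφ0 _ hq.2.2]; exact hq.2.1) (by rw [hφ0 _ hz₁.2]; exact hz₁.1) q.1 hq.1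
    rwa [hφ0 _ hq.2.2, hφ0 _ hz₁.2] at this
  refine ((continuousOn_extChartAt_symm z₀).comp hchart fun q hq =>
    (extChartAt IE z₀).map_source (hsrcD q hq)).congr fun q hq => ?_
  exact ((extChartAt IE z₀).left_inv (hsrcD q hq)).symm

/-- The forward flow is jointly continuous in time and starting point. -/
theorem continuousOn_flow
    (hv : ContMDiff IE IE.tangent 1 (fun z : E => (⟨z, v z⟩ : TangentBundle IE E)))
    (hφ0 : ∀ z ∈ S, φ z 0 = z) (hφ : ∀ z ∈ S, IsForwardSolutionIn IE v S (φ z)) (T : ℝ) :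
    ContinuousOn (fun q : ℝ × E => φ q.2 q.1) (Icc 0 T ×ˢ S) := by
  rintro ⟨t₀, z₀⟩ ⟨ht₀, hz₀⟩
  have hz₀' : z₀ ∈ S := hz₀
  -- Compactness of the trajectory arc gives one time step valid along all of it; the flow is then
  -- continued in steps of length `δ`.
  have huniform : ∃ δ : ℝ, 0 < δ ∧ ∀ z ∈ φ z₀ '' Icc 0 T, ∃ O ∈ 𝓝 z,
      ContinuousOn (fun q : ℝ × E => φ q.2 q.1) (Icc 0 δ ×ˢ (O ∩ S)) := by
    have hcomp : IsCompact (φ z₀ '' Icc 0 T) := isCompact_Icc.image_of_continuousOn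
      ((hφ z₀ hz₀).1.continuousOn.mono Icc_subset_Ici_self)
    refine hcomp.induction_on ⟨1, one_pos, by simp⟩ ?_ ?_ ?_
    · rintro s t hst ⟨δ, hδ, h⟩
      exact ⟨δ, hδ, fun z hz => h z (hst hz)⟩
    · rintro s t ⟨δ, hδ, h⟩ ⟨δ', hδ', h'⟩
      refine ⟨min δ δ', lt_min hδ hδ', fun z hz => ?_⟩
      rcases hz with hz | hz
      · obtain ⟨O, hO, hc⟩ := h z hz
        exact ⟨O, hO, hc.mono (prod_mono_left (Icc_subset_Icc_right (min_le_left _ _)))⟩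
      · obtain ⟨O, hO, hc⟩ := h' z hz
        exact ⟨O, hO, hc.mono (prod_mono_left (Icc_subset_Icc_right (min_le_right _ _)))⟩
    · intro z _
      obtain ⟨O, hO, δ, hδ, hc⟩ := exists_eventually_continuousOn_flow hv hφ0 hφ z
      obtain ⟨O', hO'O, hO', hzO'⟩ := mem_nhds_iff.1 hO
      exact ⟨O', mem_nhdsWithin_of_mem_nhds (hO'.mem_nhds hzO'), δ, hδ, fun y hy =>
        ⟨O', hO'.mem_nhds hy, hc.mono (prod_mono_right (inter_subset_inter_left _ hO'O))⟩⟩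
  obtain ⟨δ, hδ, hgood⟩ := huniform
  have hstep : ∀ k : ℕ, ∃ O ∈ 𝓝 z₀,
      ContinuousOn (fun q : ℝ × E => φ q.2 q.1) (Icc 0 (min T (k * δ)) ×ˢ (O ∩ S)) := by
    intro k
    have hT : 0 ≤ T := ht₀.1.trans ht₀.2
    induction k with
    | zero =>
      refine ⟨univ, univ_mem, continuousOn_snd.congr ?_⟩
      rintro ⟨t, z⟩ ⟨ht, hz⟩
      have : t = 0 := by simpa [hT] using ht
      simp only [this]
      exact hφ0 z hz.2
    | succ k ih =>
      obtain ⟨O, hO, hc⟩ := ih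
      set τ := min T (k * δ)
      have hτ : 0 ≤ τ := le_min hT (by positivity)
      obtain ⟨O', hO', hc'⟩ := hgood (φ z₀ τ) ⟨τ, ⟨hτ, min_le_left _ _⟩, rfl⟩
      have hcτ : ContinuousOn (fun z => φ z τ) (O ∩ S) :=
        hc.comp (continuousOn_const.prodMk continuousOn_id) fun z hz => ⟨⟨hτ, le_rfl⟩, hz⟩
      obtain ⟨O₁, hO₁, hO₁'⟩ : ∃ O₁ ∈ 𝓝 z₀, ∀ z ∈ O₁ ∩ (O ∩ S), φ z τ ∈ O' := by
        have := (hcτ z₀ ⟨mem_of_mem_nhds hO, hz₀'⟩).preimage_mem_nhdsWithin hO'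
        obtain ⟨O₁, hO₁, h⟩ := mem_nhdsWithin_iff_exists_mem_nhds_inter.1 this
        exact ⟨O₁, hO₁, h⟩
      refine ⟨O₁ ∩ O, inter_mem hO₁ hO, ?_⟩
      have hA : ContinuousOn (fun q : ℝ × E => φ q.2 q.1) (Icc 0 τ ×ˢ ((O₁ ∩ O) ∩ S)) :=
        hc.mono (prod_mono_right fun z hz => ⟨hz.1.2, hz.2⟩)
      -- On the next time slab the flow is the short-time flow near `φ z₀ τ` composed with the
      -- time-`τ` map.
      have hB : ContinuousOn (fun q : ℝ × E => φ q.2 q.1)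
          (Icc τ (τ + δ) ×ˢ ((O₁ ∩ O) ∩ S)) := by
        have hmap : ContinuousOn (fun q : ℝ × E => (q.1 - τ, φ q.2 τ))
            (Icc τ (τ + δ) ×ˢ ((O₁ ∩ O) ∩ S)) :=
          (continuousOn_fst.sub continuousOn_const).prodMk
            (hcτ.comp continuousOn_snd fun q hq => ⟨hq.2.1.2, hq.2.2⟩)
        refine (hc'.comp hmap fun q hq => ⟨⟨sub_nonneg.2 hq.1.1, by linarith [hq.1.2]⟩,
          hO₁' _ ⟨hq.2.1.1, hq.2.1.2, hq.2.2⟩, (hφ _ hq.2.2).2 _ hτ⟩).congr ?_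
        intro q hq
        have := IsForwardSolutionIn.flow_add hv hφ0 hφ hq.2.2 hτ (sub_nonneg.2 hq.1.1)
        rwa [sub_add_cancel] at this
      have hclosed : ∀ a b : ℝ, IsClosed (Icc a b ×ˢ (univ : Set E)) := fun a b =>
        isClosed_Icc.prod isClosed_univ
      rintro ⟨t, z⟩ ⟨ht, hz⟩
      have hAB : Icc 0 (min T ((k + 1 : ℕ) * δ)) ×ˢ ((O₁ ∩ O) ∩ S) ⊆
          Icc 0 τ ×ˢ ((O₁ ∩ O) ∩ S) ∪ Icc τ (τ + δ) ×ˢ ((O₁ ∩ O) ∩ S) := by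
        rintro ⟨t, z⟩ ⟨ht, hz⟩
        rcases le_total t τ with h | h
        · exact Or.inl ⟨⟨ht.1, h⟩, hz⟩
        · refine Or.inr ⟨⟨h, ht.2.trans ?_⟩, hz⟩
          rw [← min_add_add_right]
          refine le_min ((min_le_left _ _).trans (by linarith)) ((min_le_right _ _).trans ?_)
          push_cast
          linarith
      refine ContinuousWithinAt.mono ?_ hAB
      -- The time slabs are closed, so at a point outside one of them continuity within it is
      -- vacuous.
      have hcase : ∀ a b : ℝ, ContinuousOn (fun q : ℝ × E => φ q.2 q.1)
          (Icc a b ×ˢ ((O₁ ∩ O) ∩ S)) → ContinuousWithinAt (fun q : ℝ × E => φ q.2 q.1)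
            (Icc a b ×ˢ ((O₁ ∩ O) ∩ S)) (t, z) := by
        intro a b h
        by_cases hab : t ∈ Icc a b
        · exact h (t, z) ⟨hab, hz⟩
        · refine continuousWithinAt_of_notMem_closure fun hcl => hab ?_
          exact (closure_minimal (prod_mono_right (subset_univ _)) (hclosed a b) hcl).1
      exact (hcase _ _ hA).union (hcase _ _ hB)
  obtain ⟨k, hk⟩ := exists_nat_ge (T / δ)
  obtain ⟨O, hO, hc⟩ := hstep k
  rw [min_eq_left ((div_le_iff₀ hδ).1 hk)] at hc
  refine (hc (t₀, z₀) ⟨ht₀, mem_of_mem_nhds hO, hz₀⟩).mono_of_mem_nhdsWithin ?_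
  have : univ ×ˢ O ∈ 𝓝 (t₀, z₀) := prod_mem_nhds univ_mem hO
  filter_upwards [eventually_mem_nhdsWithin, mem_nhdsWithin_of_mem_nhds this] with q hq hq'
  exact ⟨hq.1, hq'.2, hq.2⟩

end ForwardFlowContinuity

/-! ### Sections of a trivial bundle and the resulting contraction of the base -/

section TrivialBundle

/-- A map into a small chart ball is nullhomotopic. -/
theorem exists_isOpen_forall_homotopic_const (n : ℕ) {M : Type*} [TopologicalSpace M]
    [ChartedSpace (EuclideanSpace ℝ (Fin n)) M] (c : M) :
    ∃ W : Set M, IsOpen W ∧ c ∈ W ∧ ∀ g : C(M, M), (∀ x, g x ∈ W) →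
      g.Homotopic (ContinuousMap.const M c) := by
  set χ := extChartAt (𝓡 n) c
  obtain ⟨r, hr, hball⟩ := Metric.isOpen_iff.1 (isOpen_extChartAt_target (I := 𝓡 n) c) (χ c)
    (mem_extChartAt_target c)
  refine ⟨χ.source ∩ χ ⁻¹' Metric.ball (χ c) r,
    isOpen_extChartAt_preimage' c Metric.isOpen_ball,
    ⟨mem_extChartAt_source c, Metric.mem_ball_self hr⟩, fun g hg => ?_⟩
  have hχg : Continuous fun x => χ (g x) :=
    (continuousOn_extChartAt (I := 𝓡 n) c).comp_continuous g.continuous fun x => (hg x).1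
  -- The straight-line homotopy to the centre, which stays in the convex chart ball.
  have hseg : Continuous fun q : unitInterval × M => AffineMap.lineMap (χ (g q.2)) (χ c) (q.1 : ℝ) := by
    have h1 := hχg.comp (continuous_snd (X := unitInterval) (Y := M))
    have h2 : Continuous fun q : unitInterval × M => (q.1 : ℝ) := by fun_prop
    simp only [AffineMap.lineMap_apply_module]
    exact ((continuous_const.sub h2).smul h1).add (h2.smul continuous_const)
  have hmem : ∀ q : unitInterval × M,
      AffineMap.lineMap (χ (g q.2)) (χ c) (q.1 : ℝ) ∈ Metric.ball (χ c) r := fun q =>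
    (convex_ball (χ c) r).lineMap_mem (hg q.2).2 (Metric.mem_ball_self hr) q.1.2
  refine ⟨⟨⟨fun q => χ.symm (AffineMap.lineMap (χ (g q.2)) (χ c) (q.1 : ℝ)), ?_⟩, ?_, ?_⟩⟩
  · exact (continuousOn_extChartAt_symm (I := 𝓡 n) c).comp_continuous hseg
      fun q => hball (hmem q)
  · intro x
    simpa using χ.left_inv (hg x).1
  · intro x
    simpa using χ.left_inv (mem_extChartAt_source (I := 𝓡 n) c)

/-- A trivial bundle whose fibre is not a point has a section avoiding a given point. -/
theorem exists_section_ne {M U E : Type*} [TopologicalSpace M] [TopologicalSpace U]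
    [TopologicalSpace E] [Nontrivial U] {p : E → M} (φ : Trivialization U p)
    (hφ : φ.baseSet = univ) (z₁ : E) :
    ∃ i : M → E, Continuous i ∧ (∀ x, p (i x) = x) ∧ ∀ x, i x ≠ z₁ := by
  obtain ⟨u, hu⟩ := exists_ne (φ z₁).2
  have hmem : ∀ x, (x, u) ∈ φ.target := fun x => by
    rw [φ.mem_target, hφ]
    exact mem_univ x
  refine ⟨fun x => φ.toOpenPartialHomeomorph.symm (x, u), ?_, fun x =>
    φ.proj_symm_apply (hmem x), fun x hx => hu ?_⟩
  · exact φ.toOpenPartialHomeomorph.continuousOn_symm.comp_continuous (by fun_prop) hmem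
  · rw [← hx, φ.apply_symm_apply (hmem x)]

/-- The homotopy is `p ∘ r_t ∘ i`. -/
theorem nullhomotopic_id_of_deformationRetractsOnto {M E : Type*} [TopologicalSpace M]
    [TopologicalSpace E] {p : E → M} (hp : Continuous p) {z₁ : E} {i : M → E}
    (hi : Continuous i) (hpi : ∀ x, p (i x) = x) (hiz : ∀ x, i x ≠ z₁)
    {A : Set {z : E // z ≠ z₁}} (hA : DeformationRetractsOnto A) {c : M} (hc : ∀ a ∈ A, p a = c) :
    (ContinuousMap.id M).Nullhomotopic := by
  obtain ⟨r, hr, hr0, hr1, -⟩ := hA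
  refine ⟨c, ⟨⟨⟨fun q => p (r (q.1, ⟨i q.2, hiz q.2⟩)), ?_⟩, ?_, ?_⟩⟩⟩
  · exact hp.comp (continuous_subtype_val.comp (hr.comp (by fun_prop)))
  · intro x
    simp [hr0, hpi]
  · intro x
    exact hc _ (hr1 _)

/-- The flow need not reach `N` in finite time, but by compactness one time `T` brings all of `i M`
over a contractible chart ball about `c`; `p ∘ φ_t ∘ i` followed by contraction in the ball is the
homotopy. -/
theorem nullhomotopic_id_of_isGloballyAsymptoticallyStable (n : ℕ) {M : Type*}
    [TopologicalSpace M] [ChartedSpace (EuclideanSpace ℝ (Fin n)) M] [CompactSpace M]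
    {FE HE E : Type*} [NormedAddCommGroup FE] [NormedSpace ℝ FE] [FiniteDimensional ℝ FE]
    [TopologicalSpace HE] {IE : ModelWithCorners ℝ FE HE}
    [TopologicalSpace E] [ChartedSpace HE E] [IsManifold IE 1 E] [T2Space E]
    {v : (z : E) → TangentSpace IE z}
    (hv : ContMDiff IE IE.tangent 1 (fun z : E => (⟨z, v z⟩ : TangentBundle IE E)))
    {p : E → M} (hp : Continuous p) {S N : Set E} {i : M → E} (hi : Continuous i)
    (hpi : ∀ x, p (i x) = x) (hiS : ∀ x, i x ∈ S)
    (hst : IsGloballyAsymptoticallyStable IE v S N) {c : M} (hN : ∀ z ∈ N, p z = c) :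
    (ContinuousMap.id M).Nullhomotopic := by
  classical
  obtain ⟨W, hW, hcW, hcontr⟩ := exists_isOpen_forall_homotopic_const n c
  have hV₁ : p ⁻¹' W ∈ 𝓝ˢ N := (hW.preimage hp).mem_nhdsSet.2 fun z hz => by
    rw [mem_preimage, hN z hz]
    exact hcW
  obtain ⟨V₂, hV₂, hstab⟩ := hst.stable _ hV₁
  obtain ⟨V, hV, hNV, hVV₂⟩ := mem_nhdsSet_iff_exists.1 hV₂
  -- Outside `S` the curve is an arbitrary constant.
  have hflow : ∀ z, ∃ γ : ℝ → E, z ∈ S → γ 0 = z ∧ IsForwardSolutionIn IE v S γ := fun z => by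
    by_cases hz : z ∈ S
    · obtain ⟨γ, hγ⟩ := hst.complete z hz
      exact ⟨γ, fun _ => hγ⟩
    · exact ⟨fun _ => z, fun h => absurd h hz⟩
  choose φ hφ using hflow
  have hφ0 : ∀ z ∈ S, φ z 0 = z := fun z hz => (hφ z hz).1
  have hφs : ∀ z ∈ S, IsForwardSolutionIn IE v S (φ z) := fun z hz => (hφ z hz).2
  have hcont : ∀ T, ContinuousOn (fun q : ℝ × E => φ q.2 q.1) (Icc 0 T ×ˢ S) :=
    continuousOn_flow hv hφ0 hφs
  -- Attraction brings each point into `V` at some time, and its neighbours too by continuity;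
  -- stability keeps them all over `W` afterwards, so finitely many times can be replaced by their
  -- maximum.
  obtain ⟨T, hT, hTW⟩ : ∃ T : ℝ, 0 ≤ T ∧ ∀ x ∈ (univ : Set M), ∀ s, T ≤ s →
      p (φ (i x) s) ∈ W := by
    refine isCompact_univ.induction_on ⟨0, le_rfl, by simp⟩ ?_ ?_ ?_
    · rintro s t hsub ⟨T, hT, h⟩
      exact ⟨T, hT, fun x hx => h x (hsub hx)⟩
    · rintro s t ⟨T, hT, h⟩ ⟨T', hT', h'⟩
      refine ⟨max T T', hT.trans (le_max_left _ _), fun x hx s hs => ?_⟩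
      rcases hx with hx | hx
      · exact h x hx s ((le_max_left _ _).trans hs)
      · exact h' x hx s ((le_max_right _ _).trans hs)
    · intro x _
      have hev := hst.attractive (φ (i x)) (hφs _ (hiS x)) (hV.mem_nhdsSet.2 hNV)
      obtain ⟨T, hT, hTV⟩ := ((eventually_ge_atTop (0 : ℝ)).and hev).exists
      have hcT : Continuous fun y => φ (i y) T := (hcont T).comp_continuous
        (f := fun y => (T, i y)) (by fun_prop) fun y => ⟨⟨hT, le_rfl⟩, hiS y⟩
      refine ⟨_, mem_nhdsWithin_of_mem_nhds ((hV.preimage hcT).mem_nhds hTV), T, hT,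
        fun y hy s hs => ?_⟩
      have := hstab _ ((hφs _ (hiS y)).comp_add hT) (hVV₂ (by simpa using hy)) (s - T)
        (sub_nonneg.2 hs)
      simpa using this
  let g : C(M, M) := ⟨fun x => p (φ (i x) T), hp.comp ((hcont T).comp_continuous
    (f := fun y => (T, i y)) (by fun_prop) fun y => ⟨⟨hT, le_rfl⟩, hiS y⟩)⟩
  refine ⟨c, ContinuousMap.Homotopic.trans ?_ (hcontr g fun x => hTW x (mem_univ x) T le_rfl)⟩
  refine ⟨⟨⟨fun q => p (φ (i q.2) (q.1 * T)), ?_⟩, ?_, ?_⟩⟩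
  · exact hp.comp ((hcont T).comp_continuous (f := fun q : unitInterval × M => ((q.1 : ℝ) * T, i q.2))
      (by fun_prop) fun q => ⟨⟨mul_nonneg q.1.2.1 hT, mul_le_of_le_one_left hT q.1.2.2⟩,
        hiS q.2⟩)
  · intro x
    simp [hφ0 _ (hiS x), hpi]
  · intro x
    simp [g]

end TrivialBundle

/-! ### Nontriviality of the bundle -/

theorem theorem2
    -- `M` is a closed smooth manifold, not a single point
    {n : ℕ} {M : Type*} [TopologicalSpace M] [ChartedSpace (EuclideanSpace ℝ (Fin n)) M]
    [IsManifold (𝓡 n) ∞ M] [T2Space M] [SecondCountableTopology M] [CompactSpace M] [Nontrivial M]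
    -- `U` is a finite-dimensional smooth manifold, not a single point
    {FU HU U : Type*} [NormedAddCommGroup FU] [NormedSpace ℝ FU] [FiniteDimensional ℝ FU]
    [TopologicalSpace HU] (IU : ModelWithCorners ℝ FU HU)
    [TopologicalSpace U] [ChartedSpace HU U] [IsManifold IU ∞ U]
    [T2Space U] [SecondCountableTopology U] [Nontrivial U]
    -- `p : E → M` is a smooth fibre bundle with fibre `U`
    {FE HE E : Type*} [NormedAddCommGroup FE] [NormedSpace ℝ FE] [FiniteDimensional ℝ FE]
    [TopologicalSpace HE] (IE : ModelWithCorners ℝ FE HE)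
    [TopologicalSpace E] [ChartedSpace HE E] [IsManifold IE ∞ E]
    [T2Space E] [SecondCountableTopology E]
    (p : E → M) (hp : IsSmoothFibreBundle (U := U) (𝓡 n) IU IE p) :
    -- the topological form
    ((∃ z₁ : E,
        (∃ zs : {z : E // z ≠ z₁}, DeformationRetractsOnto ({zs} : Set {z : E // z ≠ z₁})) ∨
        (∃ xs : M, DeformationRetractsOnto {z : {z : E // z ≠ z₁} | p z = xs})) →
      ¬ IsTrivialBundle (U := U) (𝓡 n) IU IE p) ∧
    -- the control form
    (∀ (f : (x : M) → U → TangentSpace (𝓡 n) x) (v : (z : E) → TangentSpace IE z) (xs : M),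
      IsControlSystem (𝓡 n) IU f → IsDynamicFeedback (𝓡 n) IU IE f p v →
      (WeaklyStabilizesAlmostGlobally IE p v xs ∨ StronglyStabilizesAlmostGlobally IE p v xs) →
      ¬ IsTrivialBundle (U := U) (𝓡 n) IU IE p) := by
  have hpc : Continuous p := hp.1.continuous
  have hM := not_nullhomotopic_id_of_closed_manifold n M
  refine ⟨?_, ?_⟩
  · rintro ⟨z₁, h⟩ ⟨φ, hφ, -⟩
    obtain ⟨i, hi, hpi, hiz⟩ := exists_section_ne φ hφ z₁
    rcases h with ⟨zs, h⟩ | ⟨xs, h⟩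
    · exact hM (nullhomotopic_id_of_deformationRetractsOnto hpc hi hpi hiz h (c := p zs)
        (by simp))
    · exact hM (nullhomotopic_id_of_deformationRetractsOnto hpc hi hpi hiz h (c := xs)
        fun a ha => ha)
  · rintro f v xs - ⟨hv, -⟩ h ⟨φ, hφ, -⟩
    have : IsManifold IE 1 E := .of_le (n := ∞) (by simp)
    have hv1 := hv.of_le (m := 1) (by simp)
    rcases h with ⟨z₁, h⟩ | ⟨z₁, zs, hzs, -, h⟩
    · obtain ⟨i, hi, hpi, hiz⟩ := exists_section_ne φ hφ z₁
      exact hM (nullhomotopic_id_of_isGloballyAsymptoticallyStable n hv1 hpc hi hpi hiz h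
        (c := xs) fun z hz => hz.1)
    · obtain ⟨i, hi, hpi, hiz⟩ := exists_section_ne φ hφ z₁
      exact hM (nullhomotopic_id_of_isGloballyAsymptoticallyStable n hv1 hpc hi hpi hiz h
        (c := xs) (by simpa using hzs))
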